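/- Let $\mathcal H,\mathcal K$ be nonzero finite-dimensional complex Hilbert spaces with fixed orthonormal bases, let $\mathsf T$ denote transposition in these bases, and let $\mathfrak S(\mathcal K)$ be the set of states (positive operators of trace one) on $\mathcal K$. Write $B_h$ for the self-adjoint operators, $B(\cdot)^+$ for the positive operators, $|\psi\rangle=\sum_i|i\rangle\otimes|i\rangle\in\mathcal H\otimes\mathcal H$, and $X_\Phi=(\Phi\otimes id_{\mathcal H})(|\psi\rangle\langle\psi|)\in B(\mathcal K\otimes\mathcal H)$ for the Choi matrix of a linear map $\Phi:B(\mathcal H)\to B(\mathcal K)$; conversely $X\in B(\mathcal K\otimes\mathcal H)$ corresponds to the map $\Phi(a)=\mathrm{Tr}_{\mathcal H}[(I_{\mathcal K}\otimes a^{\mathsf T})X]$. Let $B\subset B(\mathcal H)^+$ be a faithful section of a base of $B(\mathcal H)^+$, that is, $B=\{a\in L:\ a\ge 0,\ \mathrm{Tr}\,ac=1\}$ for some real subspace $L\subseteq B_h(\mathcal H)$ and some positive definite $c$, and $B$ contains a positive definite operator. Let $\tilde B=\{y\ge 0:\ \mathrm{Tr}\,by=1\ \forall b\in B\}$ be the dual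 section and, for a set $A$ of operators on $\mathcal H$, let $A^{\mathsf T}=\{a^{\mathsf T}: a\in A\}$ and $I_{\mathcal K}\otimes A=\{I_{\mathcal K}\otimes a: a\in A\}$. For a set $A\subset B(\mathcal H)^+$ and a finite-dimensional space $\mathcal L$, an $A$-channel $B(\mathcal H)\to B(\mathcal L)$ is a completely positive map $S$ with $S(A)\subseteq\mathfrak S(\mathcal L)$, and $\mathcal C_A(\mathcal H,\mathcal L)\subset B(\mathcal L\otimes\mathcal H)^+$ is the set of Choi matrices of all $A$-channels. For a set $A$ of positive operators put $\mathcal O_A=\{x_1-x_2:\ x_1,x_2\ge 0,\ x_1+x_2\in A\}$ and $\|x\|_A=\inf\{\lambda>0:\ x\in\lambda\mathcal O_A\}$ for self-adjoint $x$. Let $\|a\|_1=\mathrm{Tr}\,|a|$, and for $a,b\ge0$ let $D_{max}(a\|b)=\log_2\inf\{\lambda>0:\ a\le\lambda b\}\in[-\infty,\infty]$ (with $\inf\emptyset=\infty$, $2^{-\infty}=0$, $2^{\infty}=\infty$). **Theorem.** Let $X\in B_h(\mathcal K\otimes\mathcal H)$, let $\Phi:B(\mathcal H)\to B(\mathcal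 K)$ be the corresponding Hermitian map, and let $\mathcal L$ be any Hilbert space with $\dim\mathcal L=\dim\mathcal H$. Then $$\|X\|_{\mathcal C_B(\mathcal H,\mathcal K)}=\sup_{\dim\mathcal L'<\infty}\ \sup_{\sigma\in\mathcal C_{\tilde B^{\mathsf T}}(\mathcal H,\mathcal L')}\|(\Phi\otimes id_{\mathcal L'})(\sigma)\|_1=\sup_{\sigma\in\mathcal C_{\tilde B^{\mathsf T}}(\mathcal H,\mathcal L)}\|(\Phi\otimes id_{\mathcal L})(\sigma)\|_1,$$ where $\sigma\in B(\mathcal L'\otimes\mathcal H)$ is regarded as an element of $B(\mathcal H\otimes\mathcal L')$ by exchanging the tensor factors. The dual norm with respect to the pairing $(X,Y)\mapsto\mathrm{Tr}\,XY$ on $B_h(\mathcal K\otimes\mathcal H)$ is $\|X\|^*_{\mathcal C_B(\mathcal H,\mathcal K)}=\|X\|_{I_{\mathcal K}\otimes B^{\mathsf T}}$, that is, $\sup\{\mathrm{Tr}\,XY:\ Y\in B_h(\mathcal K\otimes\mathcal H),\ \|Y\|_{\mathcal C_B(\mathcal H,\mathcal K)}\le1\}=\|X\|_{I_{\mathcal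 K}\otimes B^{\mathsf T}}$. Moreover, if $X\ge0$, then $$\|X\|_{\mathcal C_B(\mathcal H,\mathcal K)}=\sup_{b\in B}\mathrm{Tr}\,\Phi(b)=\inf_{Y\in\mathcal C_B(\mathcal H,\mathcal K)}2^{D_{max}(X\|Y)}$$ and $$\|X\|_{I_{\mathcal K}\otimes B^{\mathsf T}}=\inf_{b\in B}2^{D_{max}(X\|I_{\mathcal K}\otimes b^{\mathsf T})}=\sup_{Y\in\mathcal C_B(\mathcal H,\mathcal K)}\mathrm{Tr}\,XY=\sup_S\langle\psi|X_{S^*\circ\Phi}|\psi\rangle,$$ where the last supremum is over all $B$-channels $S:B(\mathcal H)\to B(\mathcal K)$ and $S^*$ is the Hilbert-Schmidt adjoint of $S$. -/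

import Mathlib

open scoped Matrix Kronecker ENNReal MatrixOrder ComplexOrder

namespace GenChan

noncomputable section

/-! Finite-dimensional Hilbert spaces with a fixed orthonormal basis are coordinate spaces `ℂⁿ` over
finite index types; operators are matrices, and `K ⊗ H` is indexed by `m × n`. -/

/-- The trace norm `‖A‖₁ = Tr |A|`. -/
def traceNorm {n : Type*} [Fintype n] [DecidableEq n] (A : Matrix n n ℂ) : ℝ :=
  (CFC.abs A).trace.re

/-- `B` is a section of a base of the positive cone: `B = L ∩ S_c` for a real subspace `L` of the
Hermitian matrices and a positive definite `c`, where `S_c = {a ≥ 0 | Tr (a c) = 1}`. -/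
def IsSection {n : Type*} [Fintype n] (B : Set (Matrix n n ℂ)) : Prop :=
  ∃ (L : Submodule ℝ (Matrix n n ℂ)) (c : Matrix n n ℂ),
    (∀ x ∈ L, x.IsHermitian) ∧ c.PosDef ∧
      B = {a | a ∈ L ∧ a.PosSemidef ∧ (a * c).trace = 1}

/-- A section is faithful if it contains a positive definite element. -/
def IsFaithfulSection {n : Type*} [Fintype n] (B : Set (Matrix n n ℂ)) : Prop :=
  IsSection B ∧ ∃ b ∈ B, b.PosDef

/-- The dual section of `B`. -/
def dualSection {n : Type*} [Fintype n] (B : Set (Matrix n n ℂ)) : Set (Matrix n n ℂ) :=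
  {y | y.PosSemidef ∧ ∀ b ∈ B, (b * y).trace = 1}

/-- The set of transposes of the elements of `B`. -/
def transposeSet {n : Type*} (B : Set (Matrix n n ℂ)) : Set (Matrix n n ℂ) :=
  Matrix.transpose '' B

/-- The set `I ⊗ B = {I ⊗ b | b ∈ B}`. -/
def idTensor (m : Type*) {n : Type*} [DecidableEq m]
    (B : Set (Matrix n n ℂ)) : Set (Matrix (m × n) (m × n) ℂ) :=
  (fun b => (1 : Matrix m m ℂ) ⊗ₖ b) '' B

/-- The set of all `x₁ - x₂` with `x₁, x₂ ≥ 0` and `x₁ + x₂ ∈ B`. -/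
def unitBall {n : Type*} (B : Set (Matrix n n ℂ)) : Set (Matrix n n ℂ) :=
  {x | ∃ x₁ x₂ : Matrix n n ℂ, x₁.PosSemidef ∧ x₂.PosSemidef ∧ x₁ + x₂ ∈ B ∧ x = x₁ - x₂}

/-- The norm `‖x‖_B` on Hermitian matrices, extending the base norm: the Minkowski functional
`inf {r > 0 | x ∈ r • unitBall B}`. -/
def baseNorm {n : Type*} (B : Set (Matrix n n ℂ)) (x : Matrix n n ℂ) : ℝ :=
  gauge (unitBall B) x

/-- `Φ ⊗ id` on matrices indexed by `n × l`: `Φ` is applied to each block in the first factor. -/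
def ampliate {n m : Type*} (l : Type*) (Φ : Matrix n n ℂ →ₗ[ℂ] Matrix m m ℂ) :
    Matrix (n × l) (n × l) ℂ →ₗ[ℂ] Matrix (m × l) (m × l) ℂ where
  toFun σ := Matrix.of fun p q => Φ (σ.submatrix (fun i => (i, p.2)) (fun j => (j, q.2))) p.1 q.1
  map_add' σ τ := by
    ext p q
    simp [Matrix.submatrix_add]
  map_smul' c σ := by
    ext p q
    simp [Matrix.submatrix_smul]

theorem ampliate_kronecker {n m l : Type*} (Φ : Matrix n n ℂ →ₗ[ℂ] Matrix m m ℂ)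
    (a : Matrix n n ℂ) (c : Matrix l l ℂ) : ampliate l Φ (a ⊗ₖ c) = Φ a ⊗ₖ c := by
  ext p q
  have h : (a ⊗ₖ c).submatrix (fun i => (i, p.2)) (fun j => (j, q.2)) = c p.2 q.2 • a := by
    ext i j
    simp [mul_comm]
  simp [ampliate, h, mul_comm]

/-- Complete positivity: every `Φ ⊗ id_k` preserves positive semidefiniteness. -/
def IsCompletelyPositive {n m : Type*} (Φ : Matrix n n ℂ →ₗ[ℂ] Matrix m m ℂ) : Prop :=
  ∀ (k : ℕ) (σ : Matrix (n × Fin k) (n × Fin k) ℂ), σ.PosSemidef →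
    (ampliate (Fin k) Φ σ).PosSemidef

/-- The unnormalised maximally entangled vector `∑ i, |i⟩ ⊗ |i⟩`. -/
def psi (n : Type*) [DecidableEq n] : n × n → ℂ := fun p => if p.1 = p.2 then 1 else 0

/-- The Choi matrix `(Φ ⊗ id)(|ψ⟩⟨ψ|)`. -/
def choi {n m : Type*} [DecidableEq n] (Φ : Matrix n n ℂ →ₗ[ℂ] Matrix m m ℂ) :
    Matrix (m × n) (m × n) ℂ :=
  ampliate n Φ (Matrix.vecMulVec (psi n) (star (psi n)))

/-- The partial trace over the second tensor factor. -/
def partialTrace₂ {m n : Type*} [Fintype n] (Z : Matrix (m × n) (m × n) ℂ) : Matrix m m ℂ :=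
  Matrix.of fun i j => ∑ k, Z (i, k) (j, k)

/-- The map `a ↦ Tr_H [(I ⊗ aᵀ) X]` corresponding to `X`. -/
def choiMap {n m : Type*} [Fintype n] [Fintype m] [DecidableEq m]
    (X : Matrix (m × n) (m × n) ℂ) : Matrix n n ℂ →ₗ[ℂ] Matrix m m ℂ where
  toFun a := partialTrace₂ (((1 : Matrix m m ℂ) ⊗ₖ aᵀ) * X)
  map_add' a b := by
    ext i j
    simp [partialTrace₂, Matrix.kronecker_add, Matrix.add_mul, Finset.sum_add_distrib]
  map_smul' c a := by
    ext i j
    simp [partialTrace₂, Matrix.kronecker_smul, Finset.mul_sum]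

theorem choi_choiMap {n m : Type*} [Fintype n] [DecidableEq n] [Fintype m] [DecidableEq m]
    (X : Matrix (m × n) (m × n) ℂ) : choi (choiMap X) = X := by
  ext ⟨i, k⟩ ⟨j, l⟩
  simp [choi, ampliate, choiMap, partialTrace₂, Matrix.mul_apply, Fintype.sum_prod_type, psi,
    Matrix.vecMulVec_apply, Matrix.one_apply]

/-- Generalized channels with respect to `B`: completely positive maps sending `B` to states. -/
def IsChannel {n m : Type*} [Fintype m] (B : Set (Matrix n n ℂ))
    (Φ : Matrix n n ℂ →ₗ[ℂ] Matrix m m ℂ) : Prop :=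
  IsCompletelyPositive Φ ∧ ∀ b ∈ B, (Φ b).PosSemidef ∧ (Φ b).trace = 1

/-- The set of Choi matrices of all generalized channels with respect to `B` with output
space `ℂᵐ`. -/
def channelSet {n : Type*} [DecidableEq n] (B : Set (Matrix n n ℂ)) (m : Type*) [Fintype m] :
    Set (Matrix (m × n) (m × n) ℂ) :=
  {Y | ∃ S : Matrix n n ℂ →ₗ[ℂ] Matrix m m ℂ, IsChannel B S ∧ Y = choi S}

/-- Exchange of the two tensor factors. -/
def flip {l n : Type*} (σ : Matrix (l × n) (l × n) ℂ) : Matrix (n × l) (n × l) ℂ :=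
  σ.submatrix Prod.swap Prod.swap

/-- The adjoint of a linear map for the inner products `⟨a, b⟩ = Tr (aᴴ b)`. -/
def hsAdjoint {n m : Type*} [DecidableEq n] [Fintype m]
    (S : Matrix n n ℂ →ₗ[ℂ] Matrix m m ℂ) : Matrix m m ℂ →ₗ[ℂ] Matrix n n ℂ where
  toFun a := Matrix.of fun i j => ((S (Matrix.single i j 1))ᴴ * a).trace
  map_add' a b := by
    ext i j
    simp [Matrix.mul_add]
  map_smul' c a := by
    ext i j
    simp

theorem trace_hsAdjoint {n m : Type*} [Fintype n] [DecidableEq n] [Fintype m]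
    (S : Matrix n n ℂ →ₗ[ℂ] Matrix m m ℂ) (a : Matrix m m ℂ) (b : Matrix n n ℂ) :
    ((hsAdjoint S a)ᴴ * b).trace = (aᴴ * S b).trace := by
  have h : S b = ∑ i, ∑ j, b i j • S (Matrix.single i j 1) := by
    conv_lhs => rw [Matrix.matrix_eq_sum_single b]
    simp only [map_sum]
    refine Finset.sum_congr rfl fun i _ => Finset.sum_congr rfl fun j _ => ?_
    rw [← map_smul, Matrix.smul_single]
    simp
  have e : ∀ i j, star ((S (Matrix.single i j 1))ᴴ * a).trace
      = (aᴴ * S (Matrix.single i j 1)).trace := by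
    intro i j
    rw [← Matrix.trace_conjTranspose, Matrix.conjTranspose_mul, Matrix.conjTranspose_conjTranspose]
  rw [h]
  simp only [Matrix.mul_sum, Matrix.trace_sum, Matrix.mul_smul, Matrix.trace_smul]
  rw [Matrix.trace, Finset.sum_comm]
  simp only [Matrix.diag_apply, Matrix.mul_apply, Matrix.conjTranspose_apply]
  rw [Finset.sum_comm]
  rw [Finset.sum_comm]
  refine Finset.sum_congr rfl fun j _ => Finset.sum_congr rfl fun i _ => ?_
  change star ((S (Matrix.single i j 1))ᴴ * a).trace * b i j = _
  rw [e, smul_eq_mul, mul_comm]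

/-- `D_max(a‖b) = log₂ inf {r > 0 | a ≤ r b}`, with value `⊤` if there is no such `r` and `⊥` if the
infimum is `0`. -/
def dMax {n : Type*} (a b : Matrix n n ℂ) : EReal :=
  ENNReal.log (sInf {t : ℝ≥0∞ | ∃ r : ℝ, 0 < r ∧ (r • b - a).PosSemidef ∧ t = ENNReal.ofReal r})
    / ((Real.log 2 : ℝ) : EReal)

/-- The extended power `2 ^ x`, with `2 ^ ⊥ = 0` and `2 ^ ⊤ = ⊤`. -/
def twoPow (x : EReal) : ℝ≥0∞ := EReal.exp (x * ((Real.log 2 : ℝ) : EReal))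

end

end GenChan

/-! The whole statement is polarity between a section and its dual. For a faithful section `A`, the
norm of the dual section is the support function of the unit ball of `A`. One inequality is
positivity of traces; the other, `mem_unitBall_dualSection`, extends a positive functional, with the
positive definite element of `A` as order unit. A section equals its bidual, so the two roles can be
exchanged.

By Choi's theorem the Choi matrices of `B`-channels form the dual section of `I ⊗ Bᵀ`
(`channelSet_eq_dualSection`). Hence the norm of `X` is the supremum of `Tr X(Y₁ - Y₂)` over
positive `Y₁ + Y₂ = I ⊗ bᵀ`, `b ∈ B`, and the dual norm follows too.

To bring in ancillas, note that the admissible `σ` are the positive matrices whose marginal `b` lies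
in `B`. If `σ = C Cᴴ`, the output is `∑ V_r X V_rᴴ` with `∑ V_rᴴ V_r = I ⊗ bᵀ`. A trace norm is a
maximum of `Tr M(P - Q)` over `P + Q = 1`, and pulling `P, Q` back through the `V_r` gives a pair
`Y₁, Y₂` as above. When `b` is invertible, a purification of `b` gives a single invertible `V`, so
every pair arises in this way; other `b` are limits.

For `X ≥ 0` the part `Y₂` can only lower the trace, and `-rb ≤ X ≤ rb` reduces to `X ≤ rb`, the
condition in `D_max`. -/

namespace GenChan

/-! ### The trace pairing on Hermitian matrices -/

section Pairing

variable {n : Type*}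

theorem isHermitian_real_smul {r : ℝ} {a : Matrix n n ℂ} (ha : a.IsHermitian) :
    (r • a).IsHermitian := by
  rw [Matrix.IsHermitian, Matrix.conjTranspose_smul, ha.eq]
  simp

theorem posSemidef_real_smul {r : ℝ} (hr : 0 ≤ r) {a : Matrix n n ℂ} (ha : a.PosSemidef) :
    (r • a).PosSemidef := by
  have : (r • a) = (r : ℂ) • a := by ext; simp
  rw [this]
  exact ha.smul (by exact_mod_cast hr)

theorem posDef_real_smul {r : ℝ} (hr : 0 < r) {a : Matrix n n ℂ} (ha : a.PosDef) :
    (r • a).PosDef := by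
  have : (r • a) = (r : ℂ) • a := by ext; simp
  rw [this]
  exact ha.smul (by exact_mod_cast hr)

variable [Fintype n]

theorem trace_mul_nonneg {A B : Matrix n n ℂ} (hA : A.PosSemidef) (hB : B.PosSemidef) :
    0 ≤ (A * B).trace := by
  classical
  obtain ⟨C, rfl⟩ := CStarAlgebra.nonneg_iff_eq_star_mul_self.mp hA.nonneg
  rw [Matrix.star_eq_conjTranspose, Matrix.mul_assoc, Matrix.trace_mul_comm]
  exact (hB.mul_mul_conjTranspose_same C).trace_nonneg

theorem trace_mul_re_nonneg {A B : Matrix n n ℂ} (hA : A.PosSemidef) (hB : B.PosSemidef) :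
    0 ≤ (A * B).trace.re :=
  (Complex.le_def.mp (trace_mul_nonneg hA hB)).1

theorem trace_mul_im_eq_zero {A B : Matrix n n ℂ} (hA : A.IsHermitian) (hB : B.IsHermitian) :
    (A * B).trace.im = 0 := by
  have h : star (A * B).trace = (A * B).trace := by
    rw [← Matrix.trace_conjTranspose, Matrix.conjTranspose_mul, hA.eq, hB.eq,
      Matrix.trace_mul_comm]
  exact Complex.conj_eq_iff_im.mp h

theorem trace_mul_eq_one_iff {A B : Matrix n n ℂ} (hA : A.IsHermitian) (hB : B.IsHermitian) :
    (A * B).trace = 1 ↔ (A * B).trace.re = 1 := by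
  refine ⟨fun h => by simp [h], fun h => Complex.ext (by simpa using h) ?_⟩
  simpa using trace_mul_im_eq_zero hA hB

theorem trace_conjTranspose_mul_re {Z a : Matrix n n ℂ} (ha : a.IsHermitian) :
    (Zᴴ * a).trace.re = (Z * a).trace.re := by
  have h : star (Z * a).trace = (Zᴴ * a).trace := by
    rw [← Matrix.trace_conjTranspose, Matrix.conjTranspose_mul, ha.eq, Matrix.trace_mul_comm]
  rw [← h]
  simp

/-- Every real linear functional is represented on Hermitian matrices by a Hermitian matrix. -/
theorem exists_isHermitian_re_trace (g : Matrix n n ℂ →ₗ[ℝ] ℝ) :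
    ∃ Z : Matrix n n ℂ, Z.IsHermitian ∧ ∀ a : Matrix n n ℂ, a.IsHermitian →
      g a = (Z * a).trace.re := by
  classical
  -- The real part of `(u + iv)(x + iy)` is `ux - vy`, hence the minus sign in the imaginary part.
  let W : Matrix n n ℂ := Matrix.of fun j i =>
    ⟨g (Matrix.single i j 1), - g (Matrix.single i j Complex.I)⟩
  have hW : ∀ a, g a = (W * a).trace.re := by
    intro a
    have h : ∀ i j, g (Matrix.single i j (a i j)) = (W j i * a i j).re := by
      intro i j
      have e : Matrix.single i j (a i j) = (a i j).re • Matrix.single i j (1 : ℂ)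
          + (a i j).im • Matrix.single i j Complex.I := by
        rw [Matrix.smul_single, Matrix.smul_single, ← Matrix.single_add]
        congr 1
        simp
      rw [e, map_add, map_smul, map_smul]
      simp [W]
      ring
    conv_lhs => rw [Matrix.matrix_eq_sum_single a]
    simp only [map_sum, h, Matrix.trace, Matrix.diag_apply, Matrix.mul_apply, Complex.re_sum]
    exact Finset.sum_comm
  -- Passing to the Hermitian part does not change the pairing with Hermitian `a`.
  refine ⟨(1 / 2 : ℝ) • (W + Wᴴ), ?_, fun a ha => ?_⟩
  · rw [Matrix.IsHermitian, Matrix.conjTranspose_smul, Matrix.conjTranspose_add,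
      Matrix.conjTranspose_conjTranspose, add_comm]
    simp
  · rw [Matrix.smul_mul, Matrix.trace_smul, Complex.smul_re, Matrix.add_mul, Matrix.trace_add,
      Complex.add_re, trace_conjTranspose_mul_re ha, hW a, smul_eq_mul]
    ring

/-- Self-duality of the positive cone: testing on rank-one matrices suffices. -/
theorem posSemidef_of_re_trace_nonneg {Z : Matrix n n ℂ} (hZ : Z.IsHermitian)
    (h : ∀ p : Matrix n n ℂ, p.PosSemidef → 0 ≤ (Z * p).trace.re) : Z.PosSemidef := by
  refine .of_dotProduct_mulVec_nonneg hZ fun x => ?_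
  have e : (Z * Matrix.vecMulVec x (star x)).trace = star x ⬝ᵥ Z *ᵥ x := by
    rw [Matrix.mul_vecMulVec, Matrix.trace_vecMulVec, dotProduct_comm]
  have hp := Matrix.posSemidef_vecMulVec_self_star x
  rw [← e, Complex.le_def]
  exact ⟨h _ hp, (trace_mul_im_eq_zero hZ hp.1).symm⟩

open scoped Matrix.Norms.L2Operator in
/-- A positive definite matrix is an order unit for the Hermitian matrices. -/
theorem exists_pos_forall_smul_sub_posSemidef {c Z : Matrix n n ℂ} (hc : c.PosDef)
    (hZ : Z.IsHermitian) : ∃ r₀ : ℝ, 0 < r₀ ∧ ∀ r, r₀ ≤ r → (r • c - Z).PosSemidef := by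
  classical
  cases isEmpty_or_nonempty n with
  | inl h =>
    refine ⟨1, one_pos, fun r _ => ?_⟩
    rw [Subsingleton.elim (r • c - Z) 0]
    exact .zero
  | inr h =>
    obtain ⟨ε, hε, hεc⟩ := (CFC.exists_pos_algebraMap_le_iff (a := c) hc.1).mpr
      fun x hx => (Matrix.isStrictlyPositive_iff_posDef.mpr hc).spectrum_pos hx
    have hZ' : Z ≤ algebraMap ℝ _ ‖Z‖ := IsSelfAdjoint.le_algebraMap_norm_self (a := Z) hZ
    rw [Algebra.algebraMap_eq_smul_one, Matrix.le_iff] at hεc hZ'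
    -- From `c ≥ ε` and `Z ≤ ‖Z‖` any `r ≥ ‖Z‖ / ε` works; the `+ 1` keeps the threshold positive
    -- when `Z = 0`.
    refine ⟨(‖Z‖ + 1) / ε, by positivity, fun r hr => ?_⟩
    have hr' : ‖Z‖ ≤ r * ε := by
      rw [div_le_iff₀ hε] at hr
      linarith
    have hr0 : 0 ≤ r := le_trans (by positivity) hr
    have e : r • c - Z = r • (c - ε • 1) + (‖Z‖ • 1 - Z) + (r * ε - ‖Z‖) • (1 : Matrix n n ℂ) := by
      module
    rw [e]
    exact ((posSemidef_real_smul hr0 hεc).add hZ').add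
      (posSemidef_real_smul (by linarith) .one)

end Pairing

/-! ### Sections, their unit balls and biduality -/

section Sections

open scoped Pointwise

variable {n : Type*}

/-- Solving `x₁ + x₂ = w`, `x₁ - x₂ = x / r` gives `x₁ = (rw + x) / 2r` and `x₂ = (rw - x) / 2r`.
The order form `-rw ≤ x ≤ rw` is the one comparable with `D_max`. -/
theorem mem_smul_unitBall {B : Set (Matrix n n ℂ)} {r : ℝ} (hr : 0 < r) {x : Matrix n n ℂ} :
    x ∈ r • unitBall B ↔ ∃ w ∈ B, (r • w - x).PosSemidef ∧ (r • w + x).PosSemidef := by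
  constructor
  · rintro ⟨_, ⟨x₁, x₂, h₁, h₂, h, rfl⟩, rfl⟩
    refine ⟨x₁ + x₂, h, ?_, ?_⟩
    · convert posSemidef_real_smul (by positivity : 0 ≤ 2 * r) h₂ using 1
      module
    · convert posSemidef_real_smul (by positivity : 0 ≤ 2 * r) h₁ using 1
      module
  · rintro ⟨w, hw, h₁, h₂⟩
    refine ⟨r⁻¹ • x, ⟨(1 / (2 * r)) • (r • w + x), (1 / (2 * r)) • (r • w - x),
      posSemidef_real_smul (by positivity) h₂, posSemidef_real_smul (by positivity) h₁, ?_, ?_⟩, ?_⟩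
    · convert hw using 1
      rw [← smul_add, show r • w + x + (r • w - x) = (2 * r) • w by module, smul_smul,
        one_div_mul_cancel (by positivity), one_smul]
    · rw [← smul_sub, show r • w + x - (r • w - x) = (2 : ℝ) • x by module, smul_smul]
      congr 1
      field_simp
    · exact smul_inv_smul₀ hr.ne' x

variable [Fintype n]

theorem IsSection.exists_mem_dualSection {B : Set (Matrix n n ℂ)} (hB : IsSection B) :
    ∃ c ∈ dualSection B, c.PosDef := by
  obtain ⟨L, c, -, hc, rfl⟩ := hB
  exact ⟨c, ⟨hc.posSemidef, fun b hb => hb.2.2⟩, hc⟩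

theorem IsSection.posSemidef {B : Set (Matrix n n ℂ)} (hB : IsSection B) {b : Matrix n n ℂ}
    (hb : b ∈ B) : b.PosSemidef := by
  obtain ⟨L, c, -, hc, rfl⟩ := hB
  exact hb.2.1

theorem IsSection.convex_comb {B : Set (Matrix n n ℂ)} (hB : IsSection B) {a b : Matrix n n ℂ}
    (ha : a ∈ B) (hb : b ∈ B) {s t : ℝ} (hs : 0 ≤ s) (ht : 0 ≤ t) (hst : s + t = 1) :
    s • a + t • b ∈ B := by
  obtain ⟨L, c, hL, hc, rfl⟩ := hB
  refine ⟨L.add_mem (L.smul_mem _ ha.1) (L.smul_mem _ hb.1),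
    (posSemidef_real_smul hs ha.2.1).add (posSemidef_real_smul ht hb.2.1), ?_⟩
  rw [Matrix.add_mul, Matrix.trace_add, Matrix.smul_mul, Matrix.smul_mul, Matrix.trace_smul,
    Matrix.trace_smul, ha.2.2, hb.2.2, ← add_smul, hst, one_smul]

/-- The bidual of a section is the section itself. -/
theorem IsSection.dualSection_dualSection {B : Set (Matrix n n ℂ)} (hB : IsSection B) :
    dualSection (dualSection B) = B := by
  ext s
  constructor
  · obtain ⟨L, c, hL, hc, rfl⟩ := hB
    rintro ⟨hs, h⟩
    have hcB : c ∈ dualSection {a | a ∈ L ∧ a.PosSemidef ∧ (a * c).trace = 1} :=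
      ⟨hc.posSemidef, fun b hb => hb.2.2⟩
    have h1 : (s * c).trace = 1 := by rw [Matrix.trace_mul_comm]; exact h c hcB
    refine ⟨?_, hs, h1⟩
    by_contra hsL
    -- A functional vanishing on `L` but not at `s` is given by some Hermitian `Z`. A small multiple
    -- of `Z` can be subtracted from `c` without leaving the dual section, which forces `Tr Zs = 0`.
    obtain ⟨g, hgs, hgL⟩ := Submodule.exists_le_ker_of_notMem hsL
    obtain ⟨Z, hZ, hZg⟩ := exists_isHermitian_re_trace g
    obtain ⟨r, hr, hrZ⟩ := exists_pos_forall_smul_sub_posSemidef hc hZ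
    have hmem : c - r⁻¹ • Z ∈ dualSection {a | a ∈ L ∧ a.PosSemidef ∧ (a * c).trace = 1} := by
      have hp : (c - r⁻¹ • Z).PosSemidef := by
        convert posSemidef_real_smul (inv_nonneg.mpr hr.le) (hrZ r le_rfl) using 1
        rw [smul_sub, smul_smul, inv_mul_cancel₀ hr.ne', one_smul]
      refine ⟨hp, fun b hb => ?_⟩
      have hb0 : (Z * b).trace.re = 0 := by
        rw [← hZg b (hL b hb.1)]
        exact hgL hb.1
      rw [trace_mul_eq_one_iff (hL b hb.1) hp.1, Matrix.mul_sub, Matrix.trace_sub, hb.2.2,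
        Matrix.mul_smul, Matrix.trace_smul, Complex.sub_re, Complex.smul_re,
        Matrix.trace_mul_comm b Z, hb0]
      simp
    have h2 := h _ hmem
    rw [Matrix.sub_mul, Matrix.trace_sub, Matrix.trace_mul_comm c s, h1, Matrix.smul_mul,
      Matrix.trace_smul, sub_eq_self, smul_eq_zero] at h2
    refine hgs ?_
    rw [hZg s hs.1, h2.resolve_left (inv_ne_zero hr.ne')]
    simp
  · intro hs
    exact ⟨hB.posSemidef hs, fun y hy => by rw [Matrix.trace_mul_comm]; exact hy.2 s hs⟩

/-- The two positive definite matrices exchange roles: `b₀` now defines the base and `c` is the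
faithful element. The subspace consists of the Hermitian matrices whose trace against `b` is the
same for all `b ∈ B`. -/
theorem IsFaithfulSection.isFaithfulSection_dualSection {B : Set (Matrix n n ℂ)} (hB : IsFaithfulSection B) :
    IsFaithfulSection (dualSection B) := by
  obtain ⟨hS, b₀, hb₀, hb₀p⟩ := hB
  refine ⟨?_, hS.exists_mem_dualSection⟩
  let L : Submodule ℝ (Matrix n n ℂ) :=
    { carrier := {y | y.IsHermitian ∧ ∀ b ∈ B, (b * y).trace = (b₀ * y).trace}
      add_mem' := fun ha hb => ⟨ha.1.add hb.1, fun b hbB => by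
        rw [Matrix.mul_add, Matrix.mul_add, Matrix.trace_add, Matrix.trace_add, ha.2 b hbB,
          hb.2 b hbB]⟩
      zero_mem' := ⟨Matrix.isHermitian_zero, by simp⟩
      smul_mem' := fun r a ha => ⟨isHermitian_real_smul ha.1, fun b hbB => by
        rw [Matrix.mul_smul, Matrix.mul_smul, Matrix.trace_smul, Matrix.trace_smul, ha.2 b hbB]⟩ }
  refine ⟨L, b₀, fun x hx => hx.1, hb₀p, Set.ext fun y => ⟨fun hy => ?_, fun hy => ?_⟩⟩
  · have h1 := hy.2 b₀ hb₀
    exact ⟨⟨hy.1.1, fun b hb => by rw [hy.2 b hb, h1]⟩, hy.1, by rw [Matrix.trace_mul_comm, h1]⟩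
  · refine ⟨hy.2.1, fun b hb => ?_⟩
    rw [hy.1.2 b hb, Matrix.trace_mul_comm]
    exact hy.2.2

end Sections

/-! ### Norm duality between a section and its dual -/

section Duality

open scoped Pointwise

variable {n : Type*}

theorem unitBall.isHermitian {B : Set (Matrix n n ℂ)} {Y : Matrix n n ℂ} (hY : Y ∈ unitBall B) :
    Y.IsHermitian := by
  obtain ⟨x₁, x₂, h₁, h₂, -, rfl⟩ := hY
  exact h₁.1.sub h₂.1

variable [Fintype n]

/-- The pairing of the unit balls of a section and of its dual is bounded by one. -/
theorem re_trace_mul_le_of_mem_smul_unitBall {B : Set (Matrix n n ℂ)} {r : ℝ} (hr : 0 < r)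
    {Z Y : Matrix n n ℂ} (hZ : Z ∈ r • unitBall (dualSection B)) (hY : Y ∈ unitBall B) :
    (Z * Y).trace.re ≤ r := by
  obtain ⟨w, hw, h₁, h₂⟩ := (mem_smul_unitBall hr).mp hZ
  obtain ⟨x₁, x₂, hx₁, hx₂, hx, rfl⟩ := hY
  have e₁ := trace_mul_re_nonneg h₁ hx₁
  have e₂ := trace_mul_re_nonneg h₂ hx₂
  have e₃ := congrArg Complex.re (hw.2 _ hx)
  rw [Matrix.trace_mul_comm] at e₃
  simp only [Matrix.sub_mul, Matrix.add_mul, Matrix.mul_sub, Matrix.mul_add, Matrix.smul_mul,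
    Matrix.trace_sub, Matrix.trace_add, Matrix.trace_smul, Complex.sub_re, Complex.add_re,
    Complex.smul_re, smul_eq_mul, Complex.one_re] at e₁ e₂ e₃ ⊢
  have e₄ : r * (w * x₁).trace.re + r * (w * x₂).trace.re = r := by rw [← mul_add, e₃, mul_one]
  linarith

/-- Strong duality: a Hermitian functional bounded by one on the unit ball of a faithful section
lies in the unit ball of the dual section. -/
theorem IsFaithfulSection.mem_unitBall_dualSection {B : Set (Matrix n n ℂ)}
    (hB : IsFaithfulSection B) {Z : Matrix n n ℂ} (hZ : Z.IsHermitian)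
    (h : ∀ Y ∈ unitBall B, (Z * Y).trace.re ≤ 1) : Z ∈ unitBall (dualSection B) := by
  obtain ⟨⟨L, c, hL, hc, rfl⟩, b₀, hb₀, hb₀p⟩ := hB
  -- Twice the Hermitian part. Composing with `T` lets the extension theorem run on the space of all
  -- matrices, where anti-Hermitian parts are invisible to the cone and the subspace.
  let T : Matrix n n ℂ →ₗ[ℝ] Matrix n n ℂ :=
    { toFun := fun x => x + xᴴ
      map_add' := fun x y => by rw [Matrix.conjTranspose_add]; abel
      map_smul' := fun r x => by
        rw [Matrix.conjTranspose_smul, star_trivial, RingHom.id_apply, smul_add] }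
  have hT : ∀ x, (T x).IsHermitian := fun x => Matrix.isHermitian_add_transpose_self x
  have hTs : ∀ x : Matrix n n ℂ, x.IsHermitian → T x = (2 : ℝ) • x := fun x hx => by
    change x + xᴴ = _
    rw [hx.eq, two_smul]
  have hTr : ∀ w x : Matrix n n ℂ, w.IsHermitian →
      (w * T x).trace.re = 2 * (w * x).trace.re := fun w x hw => by
    change (w * (x + xᴴ)).trace.re = _
    rw [Matrix.mul_add, Matrix.trace_add, Complex.add_re, Matrix.trace_mul_comm w xᴴ,
      trace_conjTranspose_mul_re hw, Matrix.trace_mul_comm x w]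
    ring
  let re : Matrix n n ℂ → (Matrix n n ℂ →ₗ[ℝ] ℝ) := fun w =>
    { toFun := fun x => (w * x).trace.re
      map_add' := fun x y => by simp [Matrix.mul_add]
      map_smul' := fun r x => by simp }
  let s : PointedCone ℝ (Matrix n n ℂ × Matrix n n ℂ) :=
    { carrier := {p | (T p.1).PosSemidef ∧ (T p.2).PosSemidef}
      add_mem' := fun ha hb => by
        simp only [Set.mem_ofPred_eq, Prod.fst_add, Prod.snd_add, map_add]
        exact ⟨ha.1.add hb.1, ha.2.add hb.2⟩
      zero_mem' := by simp [Matrix.PosSemidef.zero]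
      smul_mem' := fun r p hp => by
        have e : ∀ x, T (r • x) = (r : ℝ) • T x := fun x => map_smul T (r : ℝ) x
        simp only [Set.mem_ofPred_eq, Prod.smul_fst, Prod.smul_snd, e]
        exact ⟨posSemidef_real_smul r.2 hp.1, posSemidef_real_smul r.2 hp.2⟩ }
  let D : Submodule ℝ (Matrix n n ℂ × Matrix n n ℂ) :=
    L.comap (T ∘ₗ (LinearMap.fst ℝ _ _ + LinearMap.snd ℝ _ _))
  -- `F(x₁, x₂) = Re Tr (c - Z)x₁ + Re Tr (c + Z)x₂`. A positive extension of `F` from `D` will be a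
  -- pair `(y₁, y₂)` of positive matrices, from which the decomposition of `Z` is read off.
  let F : Matrix n n ℂ × Matrix n n ℂ →ₗ[ℝ] ℝ :=
    (re c - re Z) ∘ₗ LinearMap.fst ℝ _ _ + (re c + re Z) ∘ₗ LinearMap.snd ℝ _ _
  have hF : ∀ p, F p = (c * p.1).trace.re - (Z * p.1).trace.re
      + ((c * p.2).trace.re + (Z * p.2).trace.re) := fun p => rfl
  have hD : ∀ p, p ∈ D ↔ T (p.1 + p.2) ∈ L := fun p => Iff.rfl
  -- the functional is nonnegative on the intersection with the cone
  have hbound : ∀ h₁ h₂ : Matrix n n ℂ, h₁.PosSemidef → h₂.PosSemidef → h₁ + h₂ ∈ L →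
      (Z * h₁).trace.re - (Z * h₂).trace.re ≤ (c * h₁).trace.re + (c * h₂).trace.re := by
    intro h₁ h₂ p₁ p₂ hmem
    refine le_of_forall_pos_le_add fun ε hε => ?_
    have hcb : (c * b₀).trace.re = 1 := by
      rw [Matrix.trace_mul_comm, hb₀.2.2, Complex.one_re]
    -- Adding `(ε / 2) b₀` to both `h₁` and `h₂` keeps their difference and gives the sum trace `t >
    -- 0` against `c`, so it can be normalised into the section even if `h₁ + h₂ = 0`.
    set t : ℝ := (c * h₁).trace.re + (c * h₂).trace.re + ε with ht
    have ht0 : 0 < t := by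
      have := trace_mul_re_nonneg hc.posSemidef p₁
      have := trace_mul_re_nonneg hc.posSemidef p₂
      linarith
    have q₁ := posSemidef_real_smul (inv_nonneg.mpr ht0.le)
      (p₁.add (posSemidef_real_smul (half_pos hε).le hb₀p.posSemidef))
    have q₂ := posSemidef_real_smul (inv_nonneg.mpr ht0.le)
      (p₂.add (posSemidef_real_smul (half_pos hε).le hb₀p.posSemidef))
    have hsum : t⁻¹ • (h₁ + (ε / 2) • b₀) + t⁻¹ • (h₂ + (ε / 2) • b₀)
        = t⁻¹ • ((h₁ + h₂) + ε • b₀) := by module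
    have := h _ ⟨_, _, q₁, q₂, ⟨?_, q₁.add q₂, ?_⟩, rfl⟩
    · rw [← smul_sub, add_sub_add_right_eq_sub, Matrix.mul_smul, Matrix.trace_smul,
        Complex.smul_re, Matrix.mul_sub, Matrix.trace_sub, Complex.sub_re, smul_eq_mul,
        inv_mul_le_one₀ ht0] at this
      exact this
    · rw [hsum]
      exact L.smul_mem _ (L.add_mem hmem (L.smul_mem _ hb₀.1))
    · rw [trace_mul_eq_one_iff (q₁.add q₂).1 hc.1, hsum, Matrix.trace_mul_comm, Matrix.mul_smul,
        Matrix.mul_add, Matrix.mul_add, Matrix.mul_smul, Matrix.trace_smul, Matrix.trace_add,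
        Matrix.trace_add, Matrix.trace_smul, Complex.smul_re, Complex.add_re, Complex.add_re,
        Complex.smul_re, hcb, smul_eq_mul, smul_eq_mul, mul_one, ← ht, inv_mul_cancel₀ ht0.ne']
  obtain ⟨g, hgF, hgs⟩ := riesz_extension s ⟨D, F ∘ₗ D.subtype⟩
    (by
      rintro ⟨⟨x₁, x₂⟩, hx⟩ hxs
      change 0 ≤ F (x₁, x₂)
      have := hbound (T x₁) (T x₂) hxs.1 hxs.2 (by rw [← map_add]; exact hx)
      rw [hTr _ _ hZ, hTr _ _ hZ, hTr _ _ hc.1, hTr _ _ hc.1] at this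
      rw [hF]
      linarith)
    (by
      rintro ⟨y₁, y₂⟩
      -- Cofinality: a large multiple of `(b₀, b₀)`, which lies in `D`, moves any pair into the
      -- cone.
      obtain ⟨r₁, hr₁, h₁⟩ := exists_pos_forall_smul_sub_posSemidef hb₀p (hT (-y₁))
      obtain ⟨r₂, hr₂, h₂⟩ := exists_pos_forall_smul_sub_posSemidef hb₀p (hT (-y₂))
      set r := max r₁ r₂
      have hTb : T ((r / 2) • b₀) = r • b₀ := by
        rw [map_smul, hTs _ hb₀p.1, smul_smul, div_mul_cancel₀ _ two_ne_zero]
      refine ⟨⟨((r / 2) • b₀, (r / 2) • b₀), ?_⟩, ?_⟩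
      · rw [hD, map_add, hTb]
        exact L.add_mem (L.smul_mem _ hb₀.1) (L.smul_mem _ hb₀.1)
      · change (T ((r / 2) • b₀ + y₁)).PosSemidef ∧ (T ((r / 2) • b₀ + y₂)).PosSemidef
        rw [map_add, map_add, hTb]
        have e₁ := h₁ r (le_max_left _ _)
        have e₂ := h₂ r (le_max_right _ _)
        rw [map_neg, sub_neg_eq_add] at e₁ e₂
        exact ⟨e₁, e₂⟩)
  have hgF' : ∀ p ∈ D, g p = F p := fun p hp => hgF ⟨p, hp⟩
  obtain ⟨y₁, hy₁, hg₁⟩ := exists_isHermitian_re_trace (g ∘ₗ LinearMap.inl ℝ _ _)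
  obtain ⟨y₂, hy₂, hg₂⟩ := exists_isHermitian_re_trace (g ∘ₗ LinearMap.inr ℝ _ _)
  have hTpos : ∀ p : Matrix n n ℂ, p.PosSemidef → (T p).PosSemidef := fun p hp => by
    rw [hTs p hp.1]
    exact posSemidef_real_smul zero_le_two hp
  have hp₁ : y₁.PosSemidef := posSemidef_of_re_trace_nonneg hy₁ fun p hp => by
    rw [← hg₁ p hp.1]
    exact hgs (p, 0) ⟨hTpos p hp, hTpos 0 .zero⟩
  have hp₂ : y₂.PosSemidef := posSemidef_of_re_trace_nonneg hy₂ fun p hp => by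
    rw [← hg₂ p hp.1]
    exact hgs (0, p) ⟨hTpos 0 .zero, hTpos p hp⟩
  -- Every `(a, -a)` lies in `D`, and there `F` equals `-2 Re Tr Za`.
  have hdiff : y₂ - y₁ = (2 : ℝ) • Z := by
    have hH : (y₂ - y₁ - (2 : ℝ) • Z).IsHermitian := (hy₂.sub hy₁).sub (isHermitian_real_smul hZ)
    have key : ∀ a : Matrix n n ℂ, a.IsHermitian →
        ((y₂ - y₁ - (2 : ℝ) • Z) * a).trace.re = 0 := by
      intro a ha
      have e := hgF' (a, -a) (by rw [hD]; simp)
      have e' : g (a, -a) = g (a, 0) - g (0, a) := by rw [← map_sub]; simp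
      have e₁ : g (a, 0) = (y₁ * a).trace.re := hg₁ a ha
      have e₂ : g (0, a) = (y₂ * a).trace.re := hg₂ a ha
      rw [e', e₁, e₂, hF] at e
      simp only [Matrix.mul_neg, Matrix.trace_neg, Complex.neg_re] at e
      simp only [Matrix.sub_mul, Matrix.smul_mul, Matrix.trace_sub, Matrix.trace_smul,
        Complex.sub_re, Complex.smul_re, smul_eq_mul]
      linarith
    have h0 := key _ hH
    have hpos : ((y₂ - y₁ - (2 : ℝ) • Z) * (y₂ - y₁ - (2 : ℝ) • Z)).trace = 0 :=
      Complex.ext h0 (trace_mul_im_eq_zero hH hH)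
    have : (y₂ - y₁ - (2 : ℝ) • Z) = 0 := by
      rw [← Matrix.trace_conjTranspose_mul_self_eq_zero_iff, hH.eq, hpos]
    exact sub_eq_zero.mp this
  refine ⟨(1 / 2 : ℝ) • y₂, (1 / 2 : ℝ) • y₁, posSemidef_real_smul one_half_pos.le hp₂,
    posSemidef_real_smul one_half_pos.le hp₁,
    ⟨(posSemidef_real_smul one_half_pos.le hp₂).add (posSemidef_real_smul one_half_pos.le hp₁),
      fun b hb => ?_⟩, ?_⟩
  -- On `(b, 0)` and `(0, b)` the values are `1 - Tr Zb` and `1 + Tr Zb`, so `(y₁ + y₂) / 2` has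
  -- trace one against `b`.
  · have hTb : T b ∈ L := by rw [hTs _ (hL b hb.1)]; exact L.smul_mem _ hb.1
    have e₁ := hgF' (b, 0) (by rw [hD]; simpa using hTb)
    have e₂ := hgF' (0, b) (by rw [hD]; simpa using hTb)
    have f₁ : g (b, 0) = (y₁ * b).trace.re := hg₁ b (hL b hb.1)
    have f₂ : g (0, b) = (y₂ * b).trace.re := hg₂ b (hL b hb.1)
    rw [f₁, hF] at e₁
    rw [f₂, hF] at e₂
    have hcb : (c * b).trace.re = 1 := by
      rw [Matrix.trace_mul_comm, hb.2.2, Complex.one_re]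
    simp only [Matrix.mul_zero, Matrix.trace_zero, Complex.zero_re, hcb] at e₁ e₂
    rw [trace_mul_eq_one_iff (hL b hb.1) ((isHermitian_real_smul hy₂).add
      (isHermitian_real_smul hy₁)), Matrix.trace_mul_comm]
    simp only [Matrix.add_mul, Matrix.smul_mul, Matrix.trace_add, Matrix.trace_smul,
      Complex.add_re, Complex.smul_re, smul_eq_mul]
    linarith
  · rw [← smul_sub, hdiff, smul_smul]
    norm_num

theorem IsFaithfulSection.mem_smul_unitBall_dualSection {B : Set (Matrix n n ℂ)}
    (hB : IsFaithfulSection B) {Z : Matrix n n ℂ} (hZ : Z.IsHermitian) {r : ℝ} (hr : 0 < r)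
    (h : ∀ Y ∈ unitBall B, (Z * Y).trace.re ≤ r) : Z ∈ r • unitBall (dualSection B) := by
  rw [Set.mem_smul_set_iff_inv_smul_mem₀ hr.ne']
  refine hB.mem_unitBall_dualSection (isHermitian_real_smul hZ) fun Y hY => ?_
  rw [Matrix.smul_mul, Matrix.trace_smul, Complex.smul_re, smul_eq_mul, inv_mul_le_one₀ hr]
  exact h Y hY

theorem IsFaithfulSection.exists_mem_smul_unitBall {B : Set (Matrix n n ℂ)}
    (hB : IsFaithfulSection B) {Z : Matrix n n ℂ} (hZ : Z.IsHermitian) :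
    ∃ r : ℝ, 0 < r ∧ Z ∈ r • unitBall B := by
  obtain ⟨-, b, hb, hbp⟩ := hB
  obtain ⟨r₁, hr₁, h₁⟩ := exists_pos_forall_smul_sub_posSemidef hbp hZ
  obtain ⟨r₂, hr₂, h₂⟩ := exists_pos_forall_smul_sub_posSemidef hbp hZ.neg
  refine ⟨max r₁ r₂, lt_max_of_lt_left hr₁, (mem_smul_unitBall (lt_max_of_lt_left hr₁)).mpr
    ⟨b, hb, h₁ _ (le_max_left _ _), ?_⟩⟩
  simpa using h₂ _ (le_max_right r₁ r₂)

theorem IsFaithfulSection.exists_lt_of_baseNorm_lt {B : Set (Matrix n n ℂ)}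
    (hB : IsFaithfulSection B) {Z : Matrix n n ℂ} (hZ : Z.IsHermitian) {s : ℝ}
    (h : baseNorm B Z < s) : ∃ r : ℝ, 0 < r ∧ r < s ∧ Z ∈ r • unitBall B := by
  obtain ⟨r₀, hr₀, h₀⟩ := hB.exists_mem_smul_unitBall hZ
  -- A real infimum over the empty set would be `0`, so a witness below `s` requires nonemptiness.
  have hne : {r ∈ Set.Ioi (0 : ℝ) | Z ∈ r • unitBall B}.Nonempty := ⟨r₀, hr₀, h₀⟩
  obtain ⟨r, ⟨hr, hrZ⟩, hrs⟩ := exists_lt_of_csInf_lt hne h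
  exact ⟨r, hr, hrs, hrZ⟩

/-- The norm of the dual section is dual to the unit ball of the section. -/
theorem IsFaithfulSection.isLUB_baseNorm_dualSection {B : Set (Matrix n n ℂ)}
    (hB : IsFaithfulSection B) {Z : Matrix n n ℂ} (hZ : Z.IsHermitian) :
    IsLUB {v : ℝ | ∃ Y ∈ unitBall B, v = (Z * Y).trace.re} (baseNorm (dualSection B) Z) := by
  constructor
  · rintro _ ⟨Y, hY, rfl⟩
    refine le_of_forall_gt_imp_ge_of_dense fun s hs => ?_
    obtain ⟨r, hr, hrs, hrZ⟩ := hB.isFaithfulSection_dualSection.exists_lt_of_baseNorm_lt hZ hs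
    exact (re_trace_mul_le_of_mem_smul_unitBall hr hrZ hY).trans hrs.le
  · intro u hu
    -- The unit ball contains `0 = b/2 - b/2`; this makes the scales `s > u` positive.
    have hu0 : 0 ≤ u := by
      obtain ⟨-, b, hb, hbp⟩ := hB
      refine hu ⟨0, ⟨(1 / 2 : ℝ) • b, (1 / 2 : ℝ) • b,
        posSemidef_real_smul (by norm_num) hbp.posSemidef,
        posSemidef_real_smul (by norm_num) hbp.posSemidef, ?_, (sub_self _).symm⟩, by simp⟩
      rw [← add_smul]
      norm_num [hb]
    refine le_of_forall_gt_imp_ge_of_dense fun s hs => gauge_le_of_mem (hu0.trans hs.le) ?_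
    exact hB.mem_smul_unitBall_dualSection hZ (hu0.trans_lt hs)
      fun Y hY => (hu ⟨Y, hY, rfl⟩).trans hs.le

theorem IsFaithfulSection.isLUB_baseNorm {B : Set (Matrix n n ℂ)} (hB : IsFaithfulSection B)
    {Z : Matrix n n ℂ} (hZ : Z.IsHermitian) :
    IsLUB {v : ℝ | ∃ Y ∈ unitBall (dualSection B), v = (Z * Y).trace.re}
      (baseNorm B Z) := by
  simpa only [hB.1.dualSection_dualSection] using hB.isFaithfulSection_dualSection.isLUB_baseNorm_dualSection hZ

theorem IsFaithfulSection.isLUB_baseNorm_dual {B : Set (Matrix n n ℂ)} (hB : IsFaithfulSection B)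
    {Z : Matrix n n ℂ} (hZ : Z.IsHermitian) :
    IsLUB {v : ℝ | ∃ Y : Matrix n n ℂ, Y.IsHermitian ∧
      baseNorm (dualSection B) Y ≤ 1 ∧ v = (Z * Y).trace.re} (baseNorm B Z) := by
  have hlub := hB.isLUB_baseNorm hZ
  constructor
  · rintro _ ⟨Y, hY, hY1, rfl⟩
    have h0 : 0 ≤ baseNorm B Z := gauge_nonneg Z
    -- A gauge at most one gives membership only in dilates by some `r < s`, for each `s > 1`; the
    -- loss vanishes as `s → 1`.
    have key : ∀ s : ℝ, 1 < s → (Z * Y).trace.re ≤ s * baseNorm B Z := by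
      intro s hs
      obtain ⟨r, hr, hrs, W, hW, rfl⟩ :=
        hB.isFaithfulSection_dualSection.exists_lt_of_baseNorm_lt hY (hY1.trans_lt hs)
      have := hlub.1 ⟨W, hW, rfl⟩
      change (Z * r • W).trace.re ≤ _
      rw [Matrix.mul_smul, Matrix.trace_smul, Complex.smul_re, smul_eq_mul]
      calc r * (Z * W).trace.re ≤ r * baseNorm B Z := by gcongr
        _ ≤ s * baseNorm B Z := by gcongr
    refine le_of_forall_pos_le_add fun ε hε => ?_
    -- The `+ 1` avoids dividing by zero when the norm vanishes.
    have hδ : 0 < ε / (baseNorm B Z + 1) := by positivity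
    refine (key (1 + ε / (baseNorm B Z + 1)) (by linarith)).trans ?_
    rw [add_mul, one_mul, div_mul_eq_mul_div]
    gcongr
    rw [div_le_iff₀ (by positivity)]
    nlinarith
  · intro u hu
    refine hlub.2 ?_
    rintro _ ⟨Y, hY, rfl⟩
    exact hu ⟨Y, unitBall.isHermitian hY, gauge_le_one_of_mem hY, rfl⟩

end Duality

/-! ### Positive elements and `D_max` -/

section Positive

variable {n : Type*}

theorem twoPow_dMax (a b : Matrix n n ℂ) : twoPow (dMax a b)
    = sInf {t : ℝ≥0∞ | ∃ r : ℝ, 0 < r ∧ (r • b - a).PosSemidef ∧ t = ENNReal.ofReal r} := by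
  have h2 : (0 : ℝ) < Real.log 2 := Real.log_pos one_lt_two
  rw [twoPow, dMax, EReal.div_mul_cancel (by simp) (by simp) (by exact_mod_cast h2.ne'),
    ENNReal.exp_log]

variable [Fintype n]

/-- For `Z ≥ 0`, `Tr Z(x₁ - x₂) ≤ Tr Z(x₁ + x₂)`, so elements of `B` itself suffice in the supremum
over its unit ball. -/
theorem IsFaithfulSection.isLUB_baseNorm_of_posSemidef {B : Set (Matrix n n ℂ)}
    (hB : IsFaithfulSection B) {Z : Matrix n n ℂ} (hZ : Z.PosSemidef) :
    IsLUB {v : ℝ | ∃ b ∈ B, v = (Z * b).trace.re} (baseNorm (dualSection B) Z) := by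
  have hlub := hB.isLUB_baseNorm_dualSection hZ.1
  constructor
  · rintro _ ⟨b, hb, rfl⟩
    exact hlub.1 ⟨b, ⟨b, 0, hB.1.posSemidef hb, .zero, by simpa using hb, by simp⟩, rfl⟩
  · intro u hu
    refine hlub.2 ?_
    rintro _ ⟨_, ⟨x₁, x₂, h₁, h₂, h, rfl⟩, rfl⟩
    refine le_trans ?_ (hu ⟨_, h, rfl⟩)
    have := trace_mul_re_nonneg hZ h₂
    simp only [Matrix.mul_add, Matrix.mul_sub, Matrix.trace_add, Matrix.trace_sub, Complex.add_re,
      Complex.sub_re]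
    linarith

/-- Of the two inequalities `-rb ≤ Z ≤ rb` the first is automatic for `Z ≥ 0`, and the second is the
one that `D_max` measures. -/
theorem IsFaithfulSection.ofReal_baseNorm_eq_iInf {B : Set (Matrix n n ℂ)}
    (hB : IsFaithfulSection B) {Z : Matrix n n ℂ} (hZ : Z.PosSemidef) :
    ENNReal.ofReal (baseNorm B Z) = ⨅ b ∈ B, twoPow (dMax Z b) := by
  refine le_antisymm (le_iInf₂ fun b hb => ?_) ?_
  · rw [twoPow_dMax]
    refine le_sInf ?_
    rintro _ ⟨r, hr, h, rfl⟩
    refine ENNReal.ofReal_le_ofReal (gauge_le_of_mem hr.le ((mem_smul_unitBall hr).mpr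
      ⟨b, hb, h, (posSemidef_real_smul hr.le (hB.1.posSemidef hb)).add hZ⟩))
  · have key : ∀ s : ℝ, baseNorm B Z < s → ⨅ b ∈ B, twoPow (dMax Z b) ≤ ENNReal.ofReal s := by
      intro s hs
      obtain ⟨r, hr, hrs, hrZ⟩ := hB.exists_lt_of_baseNorm_lt hZ.1 hs
      obtain ⟨b, hb, h, -⟩ := (mem_smul_unitBall hr).mp hrZ
      refine (iInf₂_le b hb).trans ?_
      rw [twoPow_dMax]
      refine le_trans (sInf_le ?_) (ENNReal.ofReal_le_ofReal hrs.le)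
      exact ⟨r, hr, h, rfl⟩
    refine ENNReal.le_of_forall_pos_le_add fun ε hε _ => ?_
    refine (key (baseNorm B Z + ε) (by simpa using hε)).trans ?_
    rw [ENNReal.ofReal_add (show 0 ≤ baseNorm B Z from gauge_nonneg Z) ε.coe_nonneg, ENNReal.ofReal_coe_nnreal]

end Positive

/-! ### Variational formula for the trace norm -/

section TraceNorm

variable {n : Type*} [Fintype n] [DecidableEq n]

/-- Pair the positive matrices `|M| - M` with `P` and `|M| + M` with `Q`, and add. -/
theorem re_trace_mul_sub_le_traceNorm {M P Q : Matrix n n ℂ} (hM : M.IsHermitian)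
    (hP : P.PosSemidef) (hQ : Q.PosSemidef) (h : P + Q = 1) :
    (M * (P - Q)).trace.re ≤ traceNorm M := by
  have hM' : IsSelfAdjoint M := hM
  have h₁ : (CFC.abs M - M).PosSemidef := by
    rw [CFC.abs_sub_self M hM', ← Matrix.nonneg_iff_posSemidef]
    exact smul_nonneg zero_le_two (CFC.negPart_nonneg M)
  have h₂ : (CFC.abs M + M).PosSemidef := by
    rw [CFC.abs_add_self M hM', ← Matrix.nonneg_iff_posSemidef]
    exact smul_nonneg zero_le_two (CFC.posPart_nonneg M)
  have e₁ := trace_mul_re_nonneg h₁ hP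
  have e₂ := trace_mul_re_nonneg h₂ hQ
  have e₃ : traceNorm M = (CFC.abs M * P).trace.re + (CFC.abs M * Q).trace.re := by
    rw [← Complex.add_re, ← Matrix.trace_add, ← Matrix.mul_add, h, Matrix.mul_one]
    rfl
  rw [e₃]
  simp only [Matrix.sub_mul, Matrix.add_mul, Matrix.mul_sub, Matrix.trace_sub, Matrix.trace_add,
    Complex.sub_re, Complex.add_re] at e₁ e₂ ⊢
  linarith

/-- `P` and `Q` are the spectral projections of `M` for `[0, ∞)` and `(-∞, 0)`, so that `M(P - Q) =
|M|`. -/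
theorem exists_traceNorm_eq {M : Matrix n n ℂ} (hM : M.IsHermitian) :
    ∃ P Q : Matrix n n ℂ, P.PosSemidef ∧ Q.PosSemidef ∧ P + Q = 1 ∧
      traceNorm M = (M * (P - Q)).trace.re := by
  have hM' : IsSelfAdjoint M := hM
  -- The spectrum is finite, so the continuous functional calculus accepts indicator functions.
  have hc : ∀ f : ℝ → ℝ, ContinuousOn f (spectrum ℝ M) := fun f =>
    (Matrix.finite_real_spectrum (A := M)).continuousOn f
  let f : ℝ → ℝ := fun x => if 0 ≤ x then 1 else 0
  let g : ℝ → ℝ := fun x => if 0 ≤ x then 0 else 1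
  refine ⟨cfc f M, cfc g M, ?_, ?_, ?_, ?_⟩
  · rw [← Matrix.nonneg_iff_posSemidef]
    exact cfc_nonneg fun x _ => by simp only [f]; split_ifs <;> norm_num
  · rw [← Matrix.nonneg_iff_posSemidef]
    exact cfc_nonneg fun x _ => by simp only [g]; split_ifs <;> norm_num
  · rw [← cfc_add M f g (hc f) (hc g), ← cfc_one ℝ M]
    congr 1
    ext x
    simp only [f, g, Pi.one_apply]
    split_ifs <;> norm_num
  · have e : M * (cfc f M - cfc g M) = CFC.abs M := by
      rw [CFC.abs_eq_cfc_norm M hM', ← cfc_sub f g M (hc f) (hc g)]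
      conv_lhs => enter [1]; rw [← cfc_id' ℝ M]
      rw [← cfc_mul _ _ M (hc _) (hc _)]
      congr 1
      ext x
      simp only [f, g, Real.norm_eq_abs]
      split_ifs with h
      · simp [abs_of_nonneg h]
      · simp [abs_of_neg (not_le.mp h)]
    rw [e, traceNorm]

end TraceNorm

/-! ### Choi matrices, Kraus form and channel sets -/

section Choi

variable {m n l ι : Type*}

theorem choi_apply [DecidableEq n] (S : Matrix n n ℂ →ₗ[ℂ] Matrix m m ℂ) (p q : m × n) :
    choi S p q = S (Matrix.single p.2 q.2 1) p.1 q.1 := by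
  have h : (Matrix.vecMulVec (psi n) (star (psi n))).submatrix (fun i => (i, p.2))
      (fun j => (j, q.2)) = Matrix.single p.2 q.2 (1 : ℂ) := by
    ext i j
    simp only [psi, Matrix.submatrix_apply, Matrix.vecMulVec_apply, Pi.star_apply,
      Matrix.single_apply]
    split_ifs <;> simp_all
  rw [← h]
  rfl

variable [Fintype m] [DecidableEq m] [Fintype n]

theorem choiMap_apply (X : Matrix (m × n) (m × n) ℂ) (a : Matrix n n ℂ) (i j : m) :
    choiMap X a i j = ∑ k, ∑ p, a p k * X (i, p) (j, k) := by
  simp [choiMap, partialTrace₂, Matrix.mul_apply, Fintype.sum_prod_type, Matrix.one_apply]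

theorem choiMap_choi [DecidableEq n] (S : Matrix n n ℂ →ₗ[ℂ] Matrix m m ℂ) :
    choiMap (choi S) = S := by
  refine LinearMap.ext fun a => ?_
  ext i j
  conv_rhs => rw [Matrix.matrix_eq_sum_single a]
  simp only [choiMap_apply, choi_apply, map_sum, Matrix.sum_apply]
  rw [Finset.sum_comm]
  refine Finset.sum_congr rfl fun p _ => Finset.sum_congr rfl fun k _ => ?_
  have e : Matrix.single p k (a p k) = a p k • Matrix.single p k (1 : ℂ) := by
    rw [Matrix.smul_single, smul_eq_mul, mul_one]
  rw [e, map_smul]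
  rfl

theorem trace_choiMap (X : Matrix (m × n) (m × n) ℂ) (a : Matrix n n ℂ) :
    (choiMap X a).trace = (((1 : Matrix m m ℂ) ⊗ₖ aᵀ) * X).trace := by
  simp [choiMap, partialTrace₂, Matrix.trace, Fintype.sum_prod_type]

/-- The `r`-th column of `C`, read as a matrix from `ℂⁿ` to `ℂˡ`. -/
def columnMatrix (C : Matrix (n × l) ι ℂ) (r : ι) : Matrix l n ℂ :=
  Matrix.of fun q p => C (p, q) r

/-- A Kraus form with the roles of map and input exchanged: the input `C Cᴴ` supplies the Kraus
operators and acts on the Choi matrix `X`. The output's trace norm thereby becomes a question about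
pairings with `X`. -/
theorem ampliate_choiMap_mul_conjTranspose [Fintype ι] (X : Matrix (m × n) (m × n) ℂ)
    (C : Matrix (n × l) ι ℂ) : ampliate l (choiMap X) (C * Cᴴ)
      = ∑ r, ((1 : Matrix m m ℂ) ⊗ₖ columnMatrix C r) * X
          * ((1 : Matrix m m ℂ) ⊗ₖ columnMatrix C r)ᴴ := by
  ext ⟨i, q⟩ ⟨j, q'⟩
  simp only [ampliate, LinearMap.coe_mk, AddHom.coe_mk, Matrix.of_apply, choiMap_apply,
    Matrix.submatrix_apply, Matrix.sum_apply]
  simp only [Matrix.mul_apply, Matrix.conjTranspose_apply, Fintype.sum_prod_type,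
    Matrix.kroneckerMap_apply, Matrix.one_apply, columnMatrix, Matrix.of_apply, ite_mul, one_mul,
    zero_mul, Finset.sum_ite_eq, Finset.mem_univ, if_true, Finset.sum_const_zero,
    apply_ite star, star_zero, mul_ite, mul_zero, Finset.sum_ite_irrel, Finset.sum_mul]
  symm
  rw [Finset.sum_comm]
  refine Finset.sum_congr rfl fun k _ => ?_
  rw [Finset.sum_comm]
  refine Finset.sum_congr rfl fun p _ => Finset.sum_congr rfl fun r _ => ?_
  ring

omit [Fintype n] in
-- Only the marginal of the input matters when the identity is pulled back through its Kraus
-- operators.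
theorem sum_conjTranspose_mul_columnMatrix [Fintype ι] [Fintype l] (C : Matrix (n × l) ι ℂ) :
    ∑ r, ((1 : Matrix m m ℂ) ⊗ₖ columnMatrix C r)ᴴ * ((1 : Matrix m m ℂ) ⊗ₖ columnMatrix C r)
      = (1 : Matrix m m ℂ) ⊗ₖ (partialTrace₂ (C * Cᴴ))ᵀ := by
  have h : (partialTrace₂ (C * Cᴴ))ᵀ = ∑ r, (columnMatrix C r)ᴴ * columnMatrix C r := by
    ext k p
    simp only [partialTrace₂, Matrix.transpose_apply, Matrix.of_apply, Matrix.mul_apply,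
      Matrix.conjTranspose_apply, Matrix.sum_apply, columnMatrix]
    rw [Finset.sum_comm]
    exact Finset.sum_congr rfl fun r _ => Finset.sum_congr rfl fun q _ => mul_comm _ _
  rw [h]
  simp only [Matrix.conjTranspose_kronecker, Matrix.conjTranspose_one, ← Matrix.mul_kronecker_mul,
    Matrix.one_mul]
  ext p q
  simp [Matrix.sum_apply, Finset.mul_sum]

theorem exists_eq_mul_conjTranspose {N : Type*} [Fintype N] {σ : Matrix N N ℂ}
    (hσ : σ.PosSemidef) : ∃ C : Matrix N N ℂ, σ = C * Cᴴ := by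
  classical
  obtain ⟨C, rfl⟩ := CStarAlgebra.nonneg_iff_eq_star_mul_self.mp hσ.nonneg
  exact ⟨Cᴴ, by rw [Matrix.conjTranspose_conjTranspose]; rfl⟩

theorem ampliate_choiMap_posSemidef [Fintype l] {X : Matrix (m × n) (m × n) ℂ}
    (hX : X.PosSemidef) {σ : Matrix (n × l) (n × l) ℂ} (hσ : σ.PosSemidef) :
    (ampliate l (choiMap X) σ).PosSemidef := by
  obtain ⟨C, rfl⟩ := exists_eq_mul_conjTranspose hσ
  rw [ampliate_choiMap_mul_conjTranspose]
  exact Matrix.posSemidef_sum _ fun r _ => hX.mul_mul_conjTranspose_same _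

theorem isCompletelyPositive_choiMap {X : Matrix (m × n) (m × n) ℂ} (hX : X.PosSemidef) :
    IsCompletelyPositive (choiMap X) := fun _ _ hσ => ampliate_choiMap_posSemidef hX hσ

theorem choiMap_posSemidef {X : Matrix (m × n) (m × n) ℂ} (hX : X.PosSemidef)
    {a : Matrix n n ℂ} (ha : a.PosSemidef) : (choiMap X a).PosSemidef := by
  -- Positivity is complete positivity with a one-dimensional ancilla.
  have h := ampliate_choiMap_posSemidef (l := Unit) hX
    (ha.submatrix (Prod.fst : n × Unit → n))
  exact h.submatrix fun i => (i, ())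

omit [DecidableEq m] [Fintype m] in
-- Complete positivity is tested on ancillas `Fin k`, so the second copy of `n` is reindexed by `Fin
-- (card n)`.
theorem IsCompletelyPositive.choi_posSemidef [DecidableEq n]
    {S : Matrix n n ℂ →ₗ[ℂ] Matrix m m ℂ} (hS : IsCompletelyPositive S) :
    (choi S).PosSemidef := by
  let e := Fintype.equivFin n
  have h := hS (Fintype.card n) _ ((Matrix.posSemidef_vecMulVec_self_star (psi n)).submatrix
    (Prod.map id e.symm))
  convert h.submatrix (Prod.map id e) using 1
  ext p q
  simp [choi, ampliate, Matrix.submatrix, Prod.map]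

/-- Choi's theorem together with the trace formula `trace_choiMap`; positivity of the outputs is
automatic because `A` consists of positive matrices. -/
theorem mem_channelSet_iff [DecidableEq n] {A : Set (Matrix n n ℂ)}
    (hA : ∀ a ∈ A, a.PosSemidef) {Y : Matrix (m × n) (m × n) ℂ} :
    Y ∈ channelSet A m ↔ Y.PosSemidef ∧ ∀ a ∈ A, (((1 : Matrix m m ℂ) ⊗ₖ aᵀ) * Y).trace = 1 := by
  constructor
  · rintro ⟨S, ⟨hS, h⟩, rfl⟩
    refine ⟨hS.choi_posSemidef, fun a ha => ?_⟩
    rw [← trace_choiMap, choiMap_choi]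
    exact (h a ha).2
  · rintro ⟨hY, h⟩
    exact ⟨choiMap Y, ⟨isCompletelyPositive_choiMap hY, fun a ha =>
      ⟨choiMap_posSemidef hY (hA a ha), by rw [trace_choiMap, h a ha]⟩⟩, (choi_choiMap Y).symm⟩

theorem channelSet_eq_dualSection [DecidableEq n] {A : Set (Matrix n n ℂ)}
    (hA : ∀ a ∈ A, a.PosSemidef) :
    channelSet A m = dualSection (idTensor m (transposeSet A)) := by
  ext Y
  rw [mem_channelSet_iff hA]
  simp [dualSection, idTensor, transposeSet]

/-- Since `Tr (I ⊗ x)(I ⊗ c) = dim K · Tr xc`, the new base is defined by `I ⊗ cᵀ / dim K`.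
Positivity of `x` is recovered from a diagonal block of `I ⊗ xᵀ`. -/
theorem IsFaithfulSection.idTensor_transposeSet [Nonempty m] {B : Set (Matrix n n ℂ)}
    (hB : IsFaithfulSection B) : IsFaithfulSection (idTensor m (transposeSet B)) := by
  obtain ⟨⟨L, c, hL, hc, rfl⟩, b₀, hb₀, hb₀p⟩ := hB
  let T : Matrix n n ℂ →ₗ[ℝ] Matrix (m × n) (m × n) ℂ :=
    { toFun := fun x => (1 : Matrix m m ℂ) ⊗ₖ xᵀ
      map_add' := fun x y => by rw [Matrix.transpose_add, Matrix.kronecker_add]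
      map_smul' := fun r x => by
        rw [Matrix.transpose_smul, Matrix.kronecker_smul, RingHom.id_apply] }
  have hT : ∀ x, T x = (1 : Matrix m m ℂ) ⊗ₖ xᵀ := fun _ => rfl
  have hTpos : ∀ x : Matrix n n ℂ, (T x).PosSemidef ↔ x.PosSemidef := by
    refine fun x => ⟨fun h => ?_, fun h => Matrix.PosSemidef.one.kronecker h.transpose⟩
    rw [← Matrix.posSemidef_transpose_iff]
    have e : xᵀ = (T x).submatrix (fun i => (Classical.arbitrary m, i))
        fun i => (Classical.arbitrary m, i) := by
      ext i j
      simp [hT]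
    rw [e]
    exact h.submatrix _
  have hm : (Fintype.card m : ℂ) ≠ 0 := by simp
  have hTtr : ∀ x, (T x * T ((Fintype.card m : ℝ)⁻¹ • c)).trace = (x * c).trace := by
    intro x
    rw [map_smul, hT, hT, Matrix.mul_smul, ← Matrix.mul_kronecker_mul, Matrix.one_mul,
      Matrix.trace_smul, Matrix.trace_kronecker, Matrix.trace_one, ← Matrix.transpose_mul,
      Matrix.trace_transpose, Matrix.trace_mul_comm c x, Complex.real_smul]
    push_cast
    field_simp
  refine ⟨⟨L.map T, T ((Fintype.card m : ℝ)⁻¹ • c), ?_, ?_, ?_⟩, T b₀, ?_, ?_⟩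
  · rintro _ ⟨x, hx, rfl⟩
    rw [hT, Matrix.IsHermitian, Matrix.conjTranspose_kronecker, Matrix.conjTranspose_one,
      (hL x hx).transpose.eq]
  · exact Matrix.PosDef.one.kronecker (posDef_real_smul (by positivity) hc).transpose
  · ext Y
    constructor
    · rintro ⟨_, ⟨x, hx, rfl⟩, rfl⟩
      exact ⟨⟨x, hx.1, rfl⟩, (hTpos x).mpr hx.2.1, (hTtr x).trans hx.2.2⟩
    · rintro ⟨⟨x, hx, rfl⟩, hp, ht⟩
      exact ⟨xᵀ, ⟨x, ⟨hx, (hTpos x).mp hp, (hTtr x).symm.trans ht⟩, rfl⟩, rfl⟩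
  · exact ⟨_, ⟨b₀, hb₀, rfl⟩, rfl⟩
  · exact Matrix.PosDef.one.kronecker hb₀p.transpose

/-- The expectation in `ψ` sums the coefficients `⟨Y(e_kk'), X(e_kk')⟩`, which together form the
Hilbert–Schmidt product of the two Choi matrices. -/
theorem psi_dotProduct_choi_hsAdjoint_comp [DecidableEq n] (X Y : Matrix (m × n) (m × n) ℂ) :
    star (psi n) ⬝ᵥ (choi (hsAdjoint (choiMap Y) ∘ₗ choiMap X)).mulVec (psi n)
      = (Yᴴ * X).trace := by
  have hX : ∀ p q : m × n, X p q = choiMap X (Matrix.single p.2 q.2 1) p.1 q.1 := fun p q => by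
    rw [← choi_apply, choi_choiMap]
  have hY : ∀ p q : m × n, Y p q = choiMap Y (Matrix.single p.2 q.2 1) p.1 q.1 := fun p q => by
    rw [← choi_apply, choi_choiMap]
  have h : ∀ k k', hsAdjoint (choiMap Y) (choiMap X (Matrix.single k k' 1)) k k'
      = ∑ j, ∑ i, star (Y (i, k) (j, k')) * X (i, k) (j, k') := by
    intro k k'
    simp [hsAdjoint, Matrix.trace, Matrix.mul_apply, ← hX (_, k) (_, k'), ← hY (_, k) (_, k')]
  simp only [dotProduct, Matrix.mulVec, Fintype.sum_prod_type, psi, Pi.star_apply, choi_apply,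
    LinearMap.comp_apply]
  simp [Fintype.sum_prod_type, h, apply_ite star, Matrix.trace, Matrix.mul_apply]
  symm
  calc _ = ∑ j, ∑ k, ∑ k', ∑ i, star (Y (i, k) (j, k')) * X (i, k) (j, k') := by
        refine Finset.sum_congr rfl fun j _ => ?_
        symm
        rw [Finset.sum_comm]
        exact Finset.sum_congr rfl fun k' _ => Finset.sum_comm
    _ = _ := by
        rw [Finset.sum_comm]
        exact Finset.sum_congr rfl fun k _ => Finset.sum_comm

end Choi

/-! ### Trace norms with an ancilla -/

section Ancilla

variable {m n l : Type*} [Fintype m] [DecidableEq m] [Fintype n] [Fintype l]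

omit [Fintype m] [DecidableEq m] [Fintype n] in
theorem partialTrace₂_posSemidef {Z : Matrix (m × l) (m × l) ℂ} (hZ : Z.PosSemidef) :
    (partialTrace₂ Z).PosSemidef := by
  have h : partialTrace₂ Z = ∑ k, Z.submatrix (fun i => (i, k)) (fun i => (i, k)) := by
    ext i j
    simp [partialTrace₂, Matrix.sum_apply]
  rw [h]
  exact Matrix.posSemidef_sum _ fun k _ => hZ.submatrix _

theorem trace_mul_partialTrace₂_flip [DecidableEq l] (y : Matrix n n ℂ)
    (σ : Matrix (l × n) (l × n) ℂ) :
    (y * partialTrace₂ (flip σ)).trace = (((1 : Matrix l l ℂ) ⊗ₖ y) * σ).trace := by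
  simp only [Matrix.trace, Matrix.diag_apply, Matrix.mul_apply, Fintype.sum_prod_type,
    Matrix.kroneckerMap_apply, Matrix.one_apply, ite_mul, one_mul, zero_mul, Finset.sum_ite_irrel,
    Finset.sum_const_zero, Finset.sum_ite_eq, Finset.mem_univ, if_true, partialTrace₂, flip,
    Matrix.of_apply, Matrix.submatrix_apply, Prod.swap_prod_mk, Finset.mul_sum]
  symm
  rw [Finset.sum_comm]
  exact Finset.sum_congr rfl fun i _ => Finset.sum_comm

/-- Elements of the channel set of the transposed dual section are the positive matrices whose
marginal lies in the section. -/
theorem IsSection.mem_channelSet_transposeSet_dualSection_iff [DecidableEq n] [DecidableEq l]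
    {B : Set (Matrix n n ℂ)} (hB : IsSection B) {σ : Matrix (l × n) (l × n) ℂ} :
    σ ∈ channelSet (transposeSet (dualSection B)) l ↔
      σ.PosSemidef ∧ partialTrace₂ (flip σ) ∈ B := by
  have hA : ∀ a ∈ transposeSet (dualSection B), a.PosSemidef := by
    rintro _ ⟨y, hy, rfl⟩
    exact hy.1.transpose
  rw [mem_channelSet_iff hA]
  refine and_congr_right fun hσ => ?_
  have hp : (partialTrace₂ (flip σ)).PosSemidef := partialTrace₂_posSemidef (hσ.submatrix _)
  -- Membership in the bidual is the family of trace conditions over `dualSection B`; the transpose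
  -- in `transposeSet` cancels the one in the Choi correspondence.
  conv_rhs => rw [← hB.dualSection_dualSection]
  rw [transposeSet, Set.forall_mem_image]
  simp [dualSection, hp, ← trace_mul_partialTrace₂_flip]

omit [DecidableEq m] [Fintype m] [Fintype l] in
theorem trace_sum_conj_mul {ι N M : Type*} [Fintype ι] [Fintype N] [Fintype M]
    (V : ι → Matrix N M ℂ) (X : Matrix M M ℂ) (P : Matrix N N ℂ) :
    ((∑ r, V r * X * (V r)ᴴ) * P).trace = (X * ∑ r, (V r)ᴴ * P * V r).trace := by
  rw [Matrix.sum_mul, Matrix.mul_sum, Matrix.trace_sum, Matrix.trace_sum]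
  refine Finset.sum_congr rfl fun r _ => ?_
  rw [Matrix.mul_assoc, Matrix.mul_assoc, Matrix.trace_mul_comm]
  simp only [Matrix.mul_assoc]

theorem sum_conj_isHermitian {ι N M : Type*} [Fintype ι] [Fintype M]
    (V : ι → Matrix N M ℂ) {X : Matrix M M ℂ} (hX : X.IsHermitian) :
    (∑ r, V r * X * (V r)ᴴ).IsHermitian := by
  rw [Matrix.IsHermitian, Matrix.conjTranspose_sum]
  exact Finset.sum_congr rfl fun r _ => Matrix.isHermitian_mul_mul_conjTranspose (V r) hX

/-- Optimal `P, Q` for the output are pulled back to `∑ V_rᴴ P V_r` and `∑ V_rᴴ Q V_r`, whose sum is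
`I ⊗ bᵀ` for the marginal `b` of `σ`. -/
theorem IsSection.exists_traceNorm_ampliate_eq [DecidableEq n] [DecidableEq l]
    {B : Set (Matrix n n ℂ)} (hB : IsSection B) {X : Matrix (m × n) (m × n) ℂ}
    (hX : X.IsHermitian) {σ : Matrix (l × n) (l × n) ℂ}
    (hσ : σ ∈ channelSet (transposeSet (dualSection B)) l) :
    ∃ Y ∈ unitBall (idTensor m (transposeSet B)),
      traceNorm (ampliate l (choiMap X) (flip σ)) = (X * Y).trace.re := by
  obtain ⟨hσp, hσB⟩ := hB.mem_channelSet_transposeSet_dualSection_iff.mp hσ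
  have hfp : (flip σ).PosSemidef := hσp.submatrix _
  obtain ⟨C, hC⟩ := exists_eq_mul_conjTranspose hfp
  rw [hC] at hσB ⊢
  rw [ampliate_choiMap_mul_conjTranspose]
  set V : n × l → Matrix (m × l) (m × n) ℂ :=
    fun r => (1 : Matrix m m ℂ) ⊗ₖ columnMatrix C r
  obtain ⟨P, Q, hP, hQ, hPQ, h⟩ := exists_traceNorm_eq (sum_conj_isHermitian V hX)
  refine ⟨_, ⟨∑ r, (V r)ᴴ * P * V r, ∑ r, (V r)ᴴ * Q * V r,
    Matrix.posSemidef_sum _ fun r _ => hP.conjTranspose_mul_mul_same _,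
    Matrix.posSemidef_sum _ fun r _ => hQ.conjTranspose_mul_mul_same _, ?_, rfl⟩, ?_⟩
  · have e : ∑ r, (V r)ᴴ * P * V r + ∑ r, (V r)ᴴ * Q * V r = ∑ r, (V r)ᴴ * V r := by
      rw [← Finset.sum_add_distrib]
      refine Finset.sum_congr rfl fun r _ => ?_
      rw [← Matrix.add_mul, ← Matrix.mul_add, hPQ, Matrix.mul_one]
    rw [e, sum_conjTranspose_mul_columnMatrix]
    exact ⟨_, ⟨_, hσB, rfl⟩, rfl⟩
  · rw [h, Matrix.mul_sub, Matrix.mul_sub, Matrix.trace_sub, Matrix.trace_sub,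
      trace_sum_conj_mul, trace_sum_conj_mul]

/-- The converse of the pull-back: `σ` is a purification of `b`. It has a single Kraus operator,
which is invertible because `b` is and because the ancilla has the dimension of the input. -/
theorem IsSection.exists_le_traceNorm_ampliate [DecidableEq n] [DecidableEq l]
    (hl : Fintype.card l = Fintype.card n) {B : Set (Matrix n n ℂ)} (hB : IsSection B)
    {X : Matrix (m × n) (m × n) ℂ} (hX : X.IsHermitian) {b : Matrix n n ℂ} (hb : b ∈ B)
    (hbp : b.PosDef) {Y₁ Y₂ : Matrix (m × n) (m × n) ℂ} (hY₁ : Y₁.PosSemidef)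
    (hY₂ : Y₂.PosSemidef) (hY : Y₁ + Y₂ = (1 : Matrix m m ℂ) ⊗ₖ bᵀ) :
    ∃ σ ∈ channelSet (transposeSet (dualSection B)) l,
      (X * (Y₁ - Y₂)).trace.re ≤ traceNorm (ampliate l (choiMap X) (flip σ)) := by
  obtain ⟨D, rfl⟩ := exists_eq_mul_conjTranspose hbp.posSemidef
  have hD : IsUnit Dᵀ.det := by
    have := (Matrix.isUnit_iff_isUnit_det _).mp hbp.isUnit
    rw [Matrix.det_mul] at this
    rw [Matrix.det_transpose]
    exact isUnit_of_mul_isUnit_left this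
  let e : l ≃ n := Fintype.equivOfCardEq hl
  -- One column only: the vector with coefficient matrix `D`, whose marginal is `D Dᴴ = b`.
  let C : Matrix (n × l) Unit ℂ := Matrix.of fun p _ => D p.1 (e p.2)
  let K' : Matrix n l ℂ := (Dᵀ)⁻¹.submatrix id e
  have hK : columnMatrix C () = Dᵀ.submatrix e id := rfl
  have hKK' : columnMatrix C () * K' = 1 := by
    rw [hK, ← Matrix.submatrix_mul _ _ _ _ _ Function.bijective_id, Matrix.mul_nonsing_inv _ hD,
      Matrix.submatrix_one_equiv]
  have hK'K : K' * columnMatrix C () = 1 := by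
    rw [hK, ← Matrix.submatrix_mul _ _ _ _ _ e.bijective, Matrix.nonsing_inv_mul _ hD,
      Matrix.submatrix_id_id]
  have hpt : partialTrace₂ (C * Cᴴ) = D * Dᴴ := by
    ext p k
    simp only [partialTrace₂, Matrix.of_apply, Matrix.mul_apply, Matrix.conjTranspose_apply, C,
      Finset.univ_unique, Finset.sum_singleton]
    exact e.sum_comp fun q => D p q * star (D k q)
  have hflip : flip (flip (C * Cᴴ)) = C * Cᴴ := rfl
  set V : Matrix (m × l) (m × n) ℂ := (1 : Matrix m m ℂ) ⊗ₖ columnMatrix C () with hVdef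
  set V' : Matrix (m × n) (m × l) ℂ := (1 : Matrix m m ℂ) ⊗ₖ K' with hV'def
  have hVV' : V * V' = 1 := by
    rw [hVdef, hV'def, ← Matrix.mul_kronecker_mul, hKK', Matrix.one_mul, Matrix.one_kronecker_one]
  have hV'V : V' * V = 1 := by
    rw [hVdef, hV'def, ← Matrix.mul_kronecker_mul, hK'K, Matrix.one_mul, Matrix.one_kronecker_one]
  have hVV : Vᴴ * V = (1 : Matrix m m ℂ) ⊗ₖ (D * Dᴴ)ᵀ := by
    rw [← hpt, ← sum_conjTranspose_mul_columnMatrix]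
    simp [V]
  have hM := ampliate_choiMap_mul_conjTranspose X C
  have hMH := sum_conj_isHermitian (fun _ : Unit => V) hX
  refine ⟨flip (C * Cᴴ), hB.mem_channelSet_transposeSet_dualSection_iff.mpr
    ⟨(Matrix.posSemidef_self_mul_conjTranspose C).submatrix _, ?_⟩, ?_⟩
  · rw [hflip, hpt]
    exact hb
  · rw [hflip, hM]
    -- Thus `V'ᴴ Y₁ V'` and `V'ᴴ Y₂ V'` pull back to `Y₁` and `Y₂`, and they sum to the identity
    -- since `Y₁ + Y₂ = Vᴴ V`.
    have hinv : ∀ Y : Matrix (m × n) (m × n) ℂ, Vᴴ * (V'ᴴ * Y * V') * V = Y := fun Y => by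
      have h1 : Vᴴ * V'ᴴ = 1 := by
        rw [← Matrix.conjTranspose_mul, hV'V, Matrix.conjTranspose_one]
      calc Vᴴ * (V'ᴴ * Y * V') * V = (Vᴴ * V'ᴴ) * Y * (V' * V) := by
            simp only [Matrix.mul_assoc]
        _ = Y := by rw [h1, hV'V, Matrix.one_mul, Matrix.mul_one]
    have hone : V'ᴴ * Y₁ * V' + V'ᴴ * Y₂ * V' = 1 := by
      rw [← Matrix.add_mul, ← Matrix.mul_add, hY, ← hVV]
      calc V'ᴴ * (Vᴴ * V) * V' = (V * V')ᴴ * (V * V') := by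
            simp only [Matrix.conjTranspose_mul, Matrix.mul_assoc]
        _ = 1 := by rw [hVV', Matrix.conjTranspose_one, Matrix.one_mul]
    have key := re_trace_mul_sub_le_traceNorm hMH (hY₁.conjTranspose_mul_mul_same V')
      (hY₂.conjTranspose_mul_mul_same V') hone
    rw [Matrix.mul_sub, Matrix.trace_sub, trace_sum_conj_mul, trace_sum_conj_mul] at key
    simp only [Finset.univ_unique, Finset.sum_const, Finset.card_singleton, one_smul, hinv] at key
    rw [Matrix.mul_sub, Matrix.trace_sub]
    simpa using key

/-- An ancilla of the dimension of the input space suffices to attain the norm. -/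
theorem IsFaithfulSection.re_trace_mul_le_of_forall_traceNorm_le [DecidableEq n] [DecidableEq l]
    (hl : Fintype.card l = Fintype.card n) {B : Set (Matrix n n ℂ)} (hB : IsFaithfulSection B)
    {X : Matrix (m × n) (m × n) ℂ} (hX : X.IsHermitian) {u : ℝ}
    (hu : ∀ σ ∈ channelSet (transposeSet (dualSection B)) l,
      traceNorm (ampliate l (choiMap X) (flip σ)) ≤ u)
    {Y : Matrix (m × n) (m × n) ℂ} (hY : Y ∈ unitBall (idTensor m (transposeSet B))) :
    (X * Y).trace.re ≤ u := by
  obtain ⟨hS, b₀, hb₀, hb₀p⟩ := hB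
  obtain ⟨Y₁, Y₂, h₁, h₂, ⟨_, ⟨b, hb, rfl⟩, h⟩, rfl⟩ := hY
  have hβ : ((1 : Matrix m m ℂ) ⊗ₖ b₀ᵀ).PosSemidef :=
    Matrix.PosSemidef.one.kronecker hb₀p.posSemidef.transpose
  -- Mixing `b` with `ε b₀` makes it positive definite. The added `I ⊗ b₀ᵀ` is split evenly between
  -- `Y₁` and `Y₂`, so their difference is only scaled by `1 - ε`.
  have key : ∀ ε : ℝ, 0 < ε → ε < 1 → (1 - ε) * (X * (Y₁ - Y₂)).trace.re ≤ u := by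
    intro ε hε hε1
    have hε' : 0 ≤ 1 - ε := by linarith
    have hbε : ((1 - ε) • b + ε • b₀).PosDef :=
      Matrix.PosDef.posSemidef_add (posSemidef_real_smul hε' (hS.posSemidef hb))
        (posDef_real_smul hε hb₀p)
    obtain ⟨σ, hσ, hle⟩ := hS.exists_le_traceNorm_ampliate hl hX
      (hS.convex_comb hb hb₀ hε' hε.le (by ring)) hbε
      ((posSemidef_real_smul hε' h₁).add (posSemidef_real_smul (half_pos hε).le hβ))
      ((posSemidef_real_smul hε' h₂).add (posSemidef_real_smul (half_pos hε).le hβ))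
      (by
        rw [Matrix.transpose_add, Matrix.kronecker_add, Matrix.transpose_smul,
          Matrix.transpose_smul, Matrix.kronecker_smul, Matrix.kronecker_smul]
        change _ = _ • ((fun b => (1 : Matrix m m ℂ) ⊗ₖ b) bᵀ) + _
        rw [h]
        module)
    rw [add_sub_add_right_eq_sub, ← smul_sub, Matrix.mul_smul, Matrix.trace_smul,
      Complex.smul_re, smul_eq_mul] at hle
    exact hle.trans (hu σ hσ)
  have hlim : Filter.Tendsto (fun ε : ℝ => (1 - ε) * (X * (Y₁ - Y₂)).trace.re)
      (nhdsWithin 0 (Set.Ioi 0)) (nhds ((1 - 0) * (X * (Y₁ - Y₂)).trace.re)) :=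
    (Continuous.tendsto (by fun_prop) 0).mono_left nhdsWithin_le_nhds
  rw [sub_zero, one_mul] at hlim
  refine le_of_tendsto hlim ?_
  filter_upwards [Ioo_mem_nhdsGT one_pos] with ε hε
  exact key ε hε.1 hε.2

end Ancilla

/-! ### The ancilla formulas for the norm -/

section Main

variable {m n l : Type*} [Fintype m] [DecidableEq m] [Nonempty m] [Fintype n] [DecidableEq n]
  [Fintype l] [DecidableEq l]

theorem IsFaithfulSection.traceNorm_ampliate_le_baseNorm {B : Set (Matrix n n ℂ)}
    (hB : IsFaithfulSection B) {X : Matrix (m × n) (m × n) ℂ} (hX : X.IsHermitian)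
    {σ : Matrix (l × n) (l × n) ℂ} (hσ : σ ∈ channelSet (transposeSet (dualSection B)) l) :
    traceNorm (ampliate l (choiMap X) (flip σ)) ≤ baseNorm (channelSet B m) X := by
  obtain ⟨Y, hY, h⟩ := hB.1.exists_traceNorm_ampliate_eq hX hσ
  rw [h, channelSet_eq_dualSection fun b hb => hB.1.posSemidef hb]
  exact (hB.idTensor_transposeSet.isLUB_baseNorm_dualSection hX).1 ⟨Y, hY, rfl⟩

theorem IsFaithfulSection.isLUB_traceNorm_ampliate (hl : Fintype.card l = Fintype.card n)
    {B : Set (Matrix n n ℂ)} (hB : IsFaithfulSection B) {X : Matrix (m × n) (m × n) ℂ}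
    (hX : X.IsHermitian) :
    IsLUB {v : ℝ | ∃ σ ∈ channelSet (transposeSet (dualSection B)) l,
      v = traceNorm (ampliate l (choiMap X) (flip σ))} (baseNorm (channelSet B m) X) := by
  constructor
  · rintro _ ⟨σ, hσ, rfl⟩
    exact hB.traceNorm_ampliate_le_baseNorm hX hσ
  · intro u hu
    rw [channelSet_eq_dualSection fun b hb => hB.1.posSemidef hb]
    refine (hB.idTensor_transposeSet.isLUB_baseNorm_dualSection hX).2 ?_
    rintro _ ⟨Y, hY, rfl⟩
    exact hB.re_trace_mul_le_of_forall_traceNorm_le hl hX (fun σ hσ => hu ⟨σ, hσ, rfl⟩) hY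

theorem IsFaithfulSection.isLUB_traceNorm_ampliate_fin {B : Set (Matrix n n ℂ)}
    (hB : IsFaithfulSection B) {X : Matrix (m × n) (m × n) ℂ} (hX : X.IsHermitian) :
    IsLUB {v : ℝ | ∃ d : ℕ, ∃ σ ∈ channelSet (transposeSet (dualSection B)) (Fin d),
      v = traceNorm (ampliate (Fin d) (choiMap X) (flip σ))} (baseNorm (channelSet B m) X) := by
  constructor
  · rintro _ ⟨d, σ, hσ, rfl⟩
    exact hB.traceNorm_ampliate_le_baseNorm hX hσ
  · intro u hu
    refine (hB.isLUB_traceNorm_ampliate (Fintype.card_fin (Fintype.card n)) hX).2 ?_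
    rintro _ ⟨σ, hσ, rfl⟩
    exact hu ⟨_, σ, hσ, rfl⟩

end Main

end GenChan

/-! ### The main theorem -/

open GenChan in
theorem mainTheorem2 {n m l : Type*} [Fintype n] [DecidableEq n]
    [Fintype m] [DecidableEq m] [Nonempty m] [Fintype l] [DecidableEq l]
    (hl : Fintype.card l = Fintype.card n)
    (B : Set (Matrix n n ℂ)) (hB : GenChan.IsFaithfulSection B)
    (X : Matrix (m × n) (m × n) ℂ) (hX : X.IsHermitian)
    (Φ : Matrix n n ℂ →ₗ[ℂ] Matrix m m ℂ) (hΦ : Φ = GenChan.choiMap X) :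
    -- supremum over all finite-dimensional ancillas
    IsLUB {v : ℝ | ∃ d : ℕ, ∃ σ ∈ GenChan.channelSet
          (GenChan.transposeSet (GenChan.dualSection B)) (Fin d),
        v = GenChan.traceNorm (GenChan.ampliate (Fin d) Φ (GenChan.flip σ))}
      (GenChan.baseNorm (GenChan.channelSet B m) X) ∧
    -- an ancilla with the dimension of the input space suffices
    IsLUB {v : ℝ | ∃ σ ∈ GenChan.channelSet
          (GenChan.transposeSet (GenChan.dualSection B)) l,
        v = GenChan.traceNorm (GenChan.ampliate l Φ (GenChan.flip σ))}
      (GenChan.baseNorm (GenChan.channelSet B m) X) ∧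
    -- the dual norm
    IsLUB {v : ℝ | ∃ Y : Matrix (m × n) (m × n) ℂ, Y.IsHermitian ∧
        GenChan.baseNorm (GenChan.channelSet B m) Y ≤ 1 ∧ v = (X * Y).trace.re}
      (GenChan.baseNorm (GenChan.idTensor m (GenChan.transposeSet B)) X) ∧
    -- the positive case
    (X.PosSemidef →
      IsLUB {v : ℝ | ∃ b ∈ B, v = (Φ b).trace.re}
        (GenChan.baseNorm (GenChan.channelSet B m) X) ∧
      ENNReal.ofReal (GenChan.baseNorm (GenChan.channelSet B m) X)
        = ⨅ Y ∈ GenChan.channelSet B m, GenChan.twoPow (GenChan.dMax X Y) ∧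
      ENNReal.ofReal (GenChan.baseNorm (GenChan.idTensor m (GenChan.transposeSet B)) X)
        = ⨅ b ∈ B, GenChan.twoPow (GenChan.dMax X ((1 : Matrix m m ℂ) ⊗ₖ bᵀ)) ∧
      IsLUB {v : ℝ | ∃ Y ∈ GenChan.channelSet B m, v = (X * Y).trace.re}
        (GenChan.baseNorm (GenChan.idTensor m (GenChan.transposeSet B)) X) ∧
      IsLUB {v : ℝ | ∃ S : Matrix n n ℂ →ₗ[ℂ] Matrix m m ℂ, GenChan.IsChannel B S ∧
          v = (star (GenChan.psi n) ⬝ᵥ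
            (GenChan.choi (GenChan.hsAdjoint S ∘ₗ Φ)).mulVec (GenChan.psi n)).re}
        (GenChan.baseNorm (GenChan.idTensor m (GenChan.transposeSet B)) X)) := by
  subst hΦ
  have hA : IsFaithfulSection (idTensor m (transposeSet B)) := hB.idTensor_transposeSet
  have hC : channelSet B m = dualSection (idTensor m (transposeSet B)) :=
    channelSet_eq_dualSection fun b hb => hB.1.posSemidef hb
  have hCf : IsFaithfulSection (channelSet B m) := hC ▸ hA.isFaithfulSection_dualSection
  refine ⟨hB.isLUB_traceNorm_ampliate_fin hX, hB.isLUB_traceNorm_ampliate hl hX, ?_,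
    fun hXp => ?_⟩
  · rw [hC]
    exact hA.isLUB_baseNorm_dual hX
  have hpair : IsLUB {v : ℝ | ∃ Y ∈ channelSet B m, v = (X * Y).trace.re}
      (baseNorm (idTensor m (transposeSet B)) X) := by
    -- By biduality `I ⊗ Bᵀ` is the dual section of the channel set, so the formula for positive
    -- elements applies with the roles exchanged.
    rw [← hA.1.dualSection_dualSection, ← hC]
    exact hCf.isLUB_baseNorm_of_posSemidef hXp
  refine ⟨?_, hCf.ofReal_baseNorm_eq_iInf hXp, ?_, hpair, ?_⟩
  · rw [hC]
    convert hA.isLUB_baseNorm_of_posSemidef hXp using 2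
    ext v
    simp only [idTensor, transposeSet, Set.exists_mem_image, trace_choiMap,
      Matrix.trace_mul_comm X]
  · rw [hA.ofReal_baseNorm_eq_iInf hXp]
    simp only [idTensor, transposeSet, iInf_image]
  · convert hpair using 2
    ext v
    -- The Choi matrix of a completely positive `S` is Hermitian, so the conjugation in the
    -- Hilbert–Schmidt product disappears.
    have key : ∀ S : Matrix n n ℂ →ₗ[ℂ] Matrix m m ℂ, IsChannel B S →
        star (psi n) ⬝ᵥ (choi (hsAdjoint S ∘ₗ choiMap X)).mulVec (psi n)
          = (X * choi S).trace := by
      intro S hS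
      conv_lhs => rw [← choiMap_choi S]
      rw [psi_dotProduct_choi_hsAdjoint_comp, hS.1.choi_posSemidef.1.eq, Matrix.trace_mul_comm]
    constructor
    · rintro ⟨S, hS, rfl⟩
      exact ⟨choi S, ⟨S, hS, rfl⟩, by rw [key S hS]⟩
    · rintro ⟨_, ⟨S, hS, rfl⟩, rfl⟩
      exact ⟨S, hS, by rw [key S hS]⟩
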